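/- Let $S$ be an additive sub-semigroup of $[0,\infty)$ with $\mathbb{N}=\{0,1,2,\dots\}\subset S$, and let $c>0$ be such that $\#(S\cap[n,n+1))\le c^{n+1}$ for every $n\in\mathbb{N}$. Powers $z^\gamma=e^{\gamma\log z}$ are principal values on $\mathbb{C}\setminus(-\infty,0]$, and sums over $S$ are unconditional. Let $\mathcal{P}_S$ be the class of probability measures $\mu$ on $\mathbb{R}$ for which there are $a_\beta\in\mathbb{C}$ $(\beta\in S,\ \beta>0)$ and $r,R>0$ with $|a_\beta|\le r^\beta$, $r<c^{-1}R$ and $$\mu|_{|x|\ge R}(dx)=\sum_{\beta\in S,\ \beta>0}\operatorname{Im}\Bigl(a_\beta\bigl(\tfrac1x\bigr)^{\beta+1}\Bigr)\,dx ,$$ where $(\tfrac1x)^{\beta+1}:=e^{i(\beta+1)\pi}|x|^{-\beta-1}$ for $x<0$. **Theorem.** Let $\mu\in\mathcal{P}_S$. Then: (a) There are $m_\gamma(\mu)\in\mathbb{C}$ $(\gamma\in S)$ and $A>0$ with $m_0(\mu)=1$, $|m_\gamma(\mu)|\le A^\gamma$ for all $\gamma\in S$, $\gamma>0$, and $$\int_{\mathbb{R}}e^{ixt}\,\mu(dx)=\sum_{\gamma\in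 S}\frac{m_\gamma(\mu)}{\Gamma(\gamma+1)}\,i^\gamma t^\gamma\qquad\text{for all } t>0,$$ and the coefficients $m_\gamma(\mu)$ are uniquely determined by this expansion; $m_\gamma(\mu)$ is called the $\gamma$-complex moment of $\mu$. (b) The Cauchy–Stieltjes transform $G_\mu(z)=\int_{\mathbb{R}}\frac{1}{z-x}\,\mu(dx)$ has the expansion $G_\mu(z)=\sum_{\gamma\in S}\frac{m_\gamma(\mu)}{z^{\gamma+1}}$ for all $z$ with $\operatorname{Im}z<0$ and $|z|$ sufficiently large. Moreover, if $d_\gamma\in\mathbb{C}$ $(\gamma\in S)$ are such that $G_\mu(z)=\sum_{\gamma\in S}\frac{d_\gamma}{z^{\gamma+1}}$ for all $z$ with $\operatorname{Im}z<0$ and $|z|$ sufficiently large, then $d_\gamma=m_\gamma(\mu)$ for every $\gamma\in S$. -/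

import Mathlib

open MeasureTheory

namespace PowerLaw

noncomputable section

/-- `S` is an additive sub-semigroup of `[0, ∞)` that contains `ℕ = {0, 1, 2, …}` and has at most
`c ^ (n + 1)` elements in `[n, n + 1)` for every `n`. -/
structure IsExponentSet (S : AddSubsemigroup ℝ) (c : ℝ) : Prop where
  nonneg : ∀ x ∈ S, 0 ≤ x
  natCast_mem : ∀ n : ℕ, (n : ℝ) ∈ S
  const_pos : 0 < c
  finite_inter : ∀ n : ℕ, ((S : Set ℝ) ∩ Set.Ico (n : ℝ) (n + 1)).Finite
  ncard_inter_le : ∀ n : ℕ,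
    (((S : Set ℝ) ∩ Set.Ico (n : ℝ) (n + 1)).ncard : ℝ) ≤ c ^ (n + 1)

/-- The strictly positive elements of `S`. -/
abbrev PosPart (S : AddSubsemigroup ℝ) : Type := {β : ℝ // β ∈ S ∧ 0 < β}

/-- The power `(1/x)^s` for real `x ≠ 0`: it is `x^(-s)` for `x > 0` and
`e^{i s π} |x|^(-s)` for `x < 0`. -/
def invPow (x s : ℝ) : ℂ :=
  if 0 < x then ((x ^ (-s) : ℝ) : ℂ)
  else Complex.exp (Complex.I * s * Real.pi) * ((|x| ^ (-s) : ℝ) : ℂ)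

/-- The function `x ↦ ∑_{β ∈ S, β > 0} Im (a_β (1/x)^{β+1})`. -/
def tailDensity (S : AddSubsemigroup ℝ) (a : PosPart S → ℂ) (x : ℝ) : ℝ :=
  ∑' β : PosPart S, (a β * invPow x ((β : ℝ) + 1)).im

/-- The class of (probability) measures whose restriction to `{|x| ≥ R}` equals
`∑_{β ∈ S, β > 0} Im (a_β (1/x)^{β+1}) dx` for some `a`, `r, R > 0` with `|a_β| ≤ r^β` and
`r < c⁻¹ R`. The nonnegativity clause is part of the equality of (a priori signed) measures;
it is written out since `ENNReal.ofReal` truncates negative values. -/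
def ClassP (S : AddSubsemigroup ℝ) (c : ℝ) (μ : Measure ℝ) : Prop :=
  ∃ (a : PosPart S → ℂ) (r R : ℝ), 0 < r ∧ 0 < R ∧
    (∀ᵐ x : ℝ, R ≤ |x| → 0 ≤ tailDensity S a x) ∧
    μ.restrict {x : ℝ | R ≤ |x|} =
      (volume.restrict {x : ℝ | R ≤ |x|}).withDensity
        (fun x => ENNReal.ofReal (tailDensity S a x)) ∧
    (∀ β : PosPart S, ‖a β‖ ≤ r ^ (β : ℝ)) ∧
    r < c⁻¹ * R

/-- `∫ e^{ixt} μ(dx) = ∑_{γ ∈ S} (m_γ / Γ(γ+1)) i^γ t^γ` for all real `t > 0`. -/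
def HasFourierExpansion (S : AddSubsemigroup ℝ) (μ : Measure ℝ) (m : S → ℂ) : Prop :=
  ∀ t : ℝ, 0 < t →
    HasSum (fun γ : S => m γ / (Real.Gamma ((γ : ℝ) + 1) : ℂ) *
      Complex.I ^ ((γ : ℝ) : ℂ) * ((t ^ (γ : ℝ) : ℝ) : ℂ)) (charFun μ t)

/-- `m` is a normalised, geometrically bounded family of Fourier coefficients of `μ`. -/
structure IsComplexMomentFamily (S : AddSubsemigroup ℝ) (μ : Measure ℝ) (m : S → ℂ) : Prop where
  eq_one : ∀ γ : S, (γ : ℝ) = 0 → m γ = 1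
  bound : ∃ A : ℝ, 0 < A ∧ ∀ γ : S, 0 < (γ : ℝ) → ‖m γ‖ ≤ A ^ (γ : ℝ)
  expansion : HasFourierExpansion S μ m

open Classical in
/-- The `γ`-complex moments `m_γ(μ)`: the coefficients of the Fourier expansion of `μ`
(and `0` if there is no such expansion). -/
def complexMoment (S : AddSubsemigroup ℝ) (μ : Measure ℝ) : S → ℂ :=
  if h : ∃ m : S → ℂ, IsComplexMomentFamily S μ m then h.choose else 0

/-- The Cauchy–Stieltjes transform `G_μ(z) = ∫ 1 / (z - x) μ(dx)`. -/
def cauchyTransform (μ : Measure ℝ) (z : ℂ) : ℂ := ∫ x : ℝ, 1 / (z - (x : ℂ)) ∂μ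

/-- `G_μ(z) = ∑_{γ ∈ S} d_γ / z^{γ+1}` for all `z` with `Im z < 0` and `|z|` large, with
principal powers. -/
def HasCauchyExpansion (S : AddSubsemigroup ℝ) (μ : Measure ℝ) (d : S → ℂ) : Prop :=
  ∃ M : ℝ, ∀ z : ℂ, z.im < 0 → M < ‖z‖ →
    HasSum (fun γ : S => d γ / z ^ (((γ : ℝ) : ℂ) + 1)) (cauchyTransform μ z)

end

end PowerLaw

/-! The Cauchy transform is expanded first, and the Fourier expansion is deduced from it.

Put `x = e^w` and `F(w) = ∑ a_β e^{-βw}`. Since `c r < R`, `F` is holomorphic near `Re w ≥ log R`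
and decays exponentially there. The tail density is `Im (e^{-w} F(w))`, taken on `Im w = 0` for `x >
0` and on `Im w = -π` for `x < 0`. Let `F*(w)` be the conjugate of `F` at the conjugate of `w`, so
that `2i Im F = F - F*` on the real line. For `Im ζ < 0`, integrate `F / (ζ - e^w)` around the half
strip `-π ≤ Im w ≤ 0`, where `e^w` sweeps the lower half plane and meets `ζ` once, and `F* / (ζ -
e^w)` around `0 ≤ Im w ≤ π`, where there is no pole. The residue yields `π F(log ζ) / ζ = ∑ π a_β /
ζ^{β+1}` (`integral_tail`). What remains, two arcs `|e^w| = R` and the part of `μ` on `|x| < R`, is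
a Laurent series in `1/ζ` and touches only integer exponents. Hence `G_μ` has an expansion over `S`
with geometrically bounded coefficients (`exists_hasCauchyExpansion`).

For `Re s > 0`, the Laplace transform of the characteristic function at `s` is `-i G_μ(-is)`
(`laplace_charFun`). Transforming the candidate Fourier series term by term gives the same function
for large `Re s`, and Fourier inversion on a vertical line identifies the two originals
(`HasCauchyExpansion.hasFourierExpansion`).

Both uniqueness claims reduce to `eq_zero_of_hasSum_zero`: `S` is locally finite, so a nonzero
generalised power series has a leading term, visible as `t → 0+`. -/

namespace PowerLaw

open Filter Topology Set Interval

/-! ### Exponent sets and generalised power series -/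

namespace IsExponentSet

variable {S : AddSubsemigroup ℝ} {c : ℝ}

lemma zero_mem (hS : IsExponentSet S c) : (0 : ℝ) ∈ S := by
  simpa using hS.natCast_mem 0

lemma one_le (hS : IsExponentSet S c) : 1 ≤ c := by
  have h := hS.ncard_inter_le 0
  have h1 : 0 < ((S : Set ℝ) ∩ Set.Ico ((0 : ℕ) : ℝ) ((0 : ℕ) + 1)).ncard := by
    rw [Set.ncard_pos (hS.finite_inter 0)]
    exact ⟨0, hS.zero_mem, by simp⟩
  have h2 : (1 : ℝ) ≤ ((S : Set ℝ) ∩ Set.Ico ((0 : ℕ) : ℝ) ((0 : ℕ) + 1)).ncard := by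
    exact_mod_cast h1
  simpa using h2.trans h

/-- Grouping exponents by integer part gives at most `c^{n+1}` terms, each at most `q^n`, hence a
geometric series of ratio `c q`. This is the source of the condition `r < c⁻¹ R`. -/
lemma summable_rpow (hS : IsExponentSet S c) {q : ℝ} (hq : 0 < q) (hcq : c * q < 1) :
    Summable (fun γ : S => q ^ (γ : ℝ)) := by
  classical
  have hc := hS.one_le
  have hq1 : q ≤ 1 := by nlinarith
  have hc0 := hS.const_pos
  have hgeo : Summable (fun n : ℕ => c * (c * q) ^ n) :=
    (summable_geometric_of_lt_one (by positivity) hcq).mul_left c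
  refine summable_of_sum_le (c := ∑' n : ℕ, c * (c * q) ^ n)
    (fun γ => Real.rpow_nonneg hq.le _) fun u => ?_
  rw [← Finset.sum_fiberwise_of_maps_to (t := u.image fun γ : S => ⌊(γ : ℝ)⌋₊)
    (g := fun γ : S => ⌊(γ : ℝ)⌋₊) (fun γ hγ => Finset.mem_image_of_mem _ hγ)]
  refine (Finset.sum_le_sum fun n _ => ?_).trans
    (hgeo.sum_le_tsum _ fun n _ => by positivity)
  have hcard : ((u.filter fun γ : S => ⌊(γ : ℝ)⌋₊ = n).card : ℝ) ≤ c ^ (n + 1) := by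
    refine le_trans ?_ (hS.ncard_inter_le n)
    rw [← Set.ncard_coe_finset, Nat.cast_le,
      ← Set.ncard_image_of_injective _ (Subtype.val_injective (p := fun x => x ∈ S))]
    refine Set.ncard_le_ncard ?_ (hS.finite_inter n)
    rintro _ ⟨γ, hγ, rfl⟩
    simp only [Finset.coe_filter, Set.mem_ofPred_eq] at hγ
    have := (Nat.floor_eq_iff (hS.nonneg _ γ.2)).1 hγ.2
    exact ⟨γ.2, this⟩
  calc ∑ γ ∈ u.filter (fun γ : S => ⌊(γ : ℝ)⌋₊ = n), q ^ (γ : ℝ)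
      ≤ ∑ γ ∈ u.filter (fun γ : S => ⌊(γ : ℝ)⌋₊ = n), q ^ n := by
        refine Finset.sum_le_sum fun γ hγ => ?_
        rw [← Real.rpow_natCast]
        refine Real.rpow_le_rpow_of_exponent_ge hq hq1 ?_
        rw [← (Finset.mem_filter.1 hγ).2]
        exact Nat.floor_le (hS.nonneg _ γ.2)
    _ ≤ c ^ (n + 1) * q ^ n := by
        rw [Finset.sum_const, nsmul_eq_mul]
        gcongr
    _ = c * (c * q) ^ n := by rw [mul_pow]; ring

lemma finite_le (hS : IsExponentSet S c) (x : ℝ) :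
    {γ : S | (γ : ℝ) ≤ x}.Finite := by
  have h : (⋃ n ∈ Finset.range (⌊x⌋₊ + 1),
      ((S : Set ℝ) ∩ Set.Ico (n : ℝ) (n + 1))).Finite :=
    Set.Finite.biUnion (Finset.finite_toSet _) fun n _ => hS.finite_inter n
  refine Set.Finite.of_finite_image (f := Subtype.val) (h.subset ?_)
    Subtype.val_injective.injOn
  rintro _ ⟨γ, hγ, rfl⟩
  simp only [Set.mem_iUnion, Finset.mem_range]
  have h0 := hS.nonneg _ γ.2
  exact ⟨⌊(γ : ℝ)⌋₊, Nat.lt_succ_of_le (Nat.floor_le_floor hγ), γ.2, Nat.floor_le h0,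
    Nat.lt_floor_add_one _⟩

lemma exists_min (hS : IsExponentSet S c) {T : Set S} (hT : T.Nonempty) :
    ∃ γ ∈ T, ∀ η ∈ T, (γ : ℝ) ≤ η := by
  obtain ⟨x, hx⟩ := hT
  have hfin : (T ∩ {γ : S | (γ : ℝ) ≤ x}).Finite :=
    (hS.finite_le x).subset Set.inter_subset_right
  obtain ⟨γ, hγ, hmin⟩ := Set.exists_min_image _ (fun γ : S => (γ : ℝ)) hfin
    ⟨x, hx, le_refl (x : ℝ)⟩
  refine ⟨γ, hγ.1, fun η hη => ?_⟩
  rcases le_total (η : ℝ) x with h | h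
  · exact hmin η ⟨hη, h⟩
  · exact (hγ.2 : (γ : ℝ) ≤ x).trans h

/-- The positive elements of an exponent set are bounded away from zero. -/
lemma exists_pos_le (hS : IsExponentSet S c) :
    ∃ δ : ℝ, 0 < δ ∧ ∀ γ : S, 0 < (γ : ℝ) → δ ≤ γ := by
  obtain ⟨γ, hγ, hmin⟩ := hS.exists_min (T := {γ : S | 0 < (γ : ℝ)})
    ⟨⟨1, by simpa using hS.natCast_mem 1⟩, by simp⟩
  exact ⟨γ, hγ, hmin⟩

/-- A generalised power series whose exponents all dominate `γ₀`, divided by `t ^ γ₀`, tends to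
its coefficient at `γ₀` as `t → 0+`. -/
lemma tendsto_div_rpow {b : S → ℂ} {f : ℝ → ℂ} {t₁ : ℝ} (ht₁ : 0 < t₁)
    (hsum : ∀ t : ℝ, 0 < t → t < t₁ → HasSum (fun γ : S => b γ * ((t ^ (γ : ℝ) : ℝ) : ℂ)) (f t))
    (γ₀ : S) (hγ₀ : ∀ γ : S, b γ ≠ 0 → (γ₀ : ℝ) ≤ γ) :
    Tendsto (fun t : ℝ => f t / ((t ^ (γ₀ : ℝ) : ℝ) : ℂ)) (𝓝[>] 0) (𝓝 (b γ₀)) := by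
  classical
  -- Absolute convergence at the single point `τ` dominates the quotient series for all `0 < t < τ`.
  set τ := t₁ / 2 with hτ
  have hτ0 : 0 < τ := by positivity
  have hτ1 : τ < t₁ := by rw [hτ]; linarith
  have hkey : Tendsto (fun t : ℝ => ∑' γ : S, b γ * ((t ^ ((γ : ℝ) - γ₀) : ℝ) : ℂ)) (𝓝[>] 0)
      (𝓝 (∑' γ : S, if γ = γ₀ then b γ₀ else 0)) := by
    refine tendsto_tsum_of_dominated_convergence
      (bound := fun γ : S => ‖b γ * ((τ ^ (γ : ℝ) : ℝ) : ℂ)‖ * (τ ^ (γ₀ : ℝ))⁻¹) ?_ ?_ ?_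
    · exact ((hsum τ hτ0 hτ1).summable.norm).mul_right _
    · intro γ
      by_cases h : γ = γ₀
      · subst h
        simp
      · rw [if_neg h]
        by_cases hb : b γ = 0
        · simp [hb]
        have hpos : 0 < (γ : ℝ) - γ₀ := by
          have h1 := hγ₀ γ hb
          have h2 : (γ : ℝ) ≠ γ₀ := fun h' => h (Subtype.ext h')
          exact sub_pos.2 (lt_of_le_of_ne h1 h2.symm)
        have h1 : Tendsto (fun t : ℝ => t ^ ((γ : ℝ) - γ₀)) (𝓝[>] 0) (𝓝 0) := by
          have := (Real.continuousAt_rpow_const 0 ((γ : ℝ) - γ₀) (Or.inr hpos.le)).tendsto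
          rw [Real.zero_rpow hpos.ne'] at this
          exact this.mono_left nhdsWithin_le_nhds
        have h2 : Tendsto (fun t : ℝ => ((t ^ ((γ : ℝ) - γ₀) : ℝ) : ℂ)) (𝓝[>] 0) (𝓝 0) := by
          rw [← Complex.ofReal_zero]
          exact (Complex.continuous_ofReal.tendsto 0).comp h1
        simpa using h2.const_mul (b γ)
    · filter_upwards [Ioo_mem_nhdsGT hτ0] with t ht γ
      by_cases hb : b γ = 0
      · simp [hb]
      have h1 := sub_nonneg.2 (hγ₀ γ hb)
      rw [norm_mul, norm_mul, Complex.norm_real, Complex.norm_real,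
        Real.norm_of_nonneg (Real.rpow_nonneg ht.1.le _),
        Real.norm_of_nonneg (Real.rpow_nonneg hτ0.le _), mul_assoc, ← div_eq_mul_inv,
        ← Real.rpow_sub hτ0]
      gcongr
      · exact ht.1.le
      · exact ht.2.le
  rw [tsum_ite_eq] at hkey
  refine hkey.congr' ?_
  filter_upwards [Ioo_mem_nhdsGT ht₁] with t ht
  have hne : ((t ^ (γ₀ : ℝ) : ℝ) : ℂ) ≠ 0 := by
    exact_mod_cast (Real.rpow_pos_of_pos ht.1 _).ne'
  rw [← ((hsum t ht.1 ht.2).div_const _).tsum_eq]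
  refine tsum_congr fun γ => ?_
  rw [Real.rpow_sub ht.1]
  push_cast
  ring

/-- Uniqueness of the coefficients of a generalised power series near `0+`. -/
lemma eq_zero_of_hasSum_zero (hS : IsExponentSet S c) {b : S → ℂ} {t₁ : ℝ} (ht₁ : 0 < t₁)
    (hsum : ∀ t : ℝ, 0 < t → t < t₁ →
      HasSum (fun γ : S => b γ * ((t ^ (γ : ℝ) : ℝ) : ℂ)) 0) : b = 0 := by
  by_contra hne
  obtain ⟨γ, hγ⟩ : ∃ γ, b γ ≠ 0 := by
    by_contra h
    push Not at h
    exact hne (funext h)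
  -- The leading coefficient is a limit of zeros, which is absurd.
  obtain ⟨γ₀, h0, hmin⟩ := hS.exists_min (T := {γ | b γ ≠ 0}) ⟨γ, hγ⟩
  have := tendsto_div_rpow (f := fun _ => 0) ht₁ hsum γ₀ hmin
  simp only [zero_div] at this
  exact h0 (tendsto_nhds_unique this tendsto_const_nhds)

end IsExponentSet

/-! ### Contour integrals over rectangles -/

/-- The counterclockwise integral of `f` over the boundary of `[a, b] × [y₁, y₂]`. -/
noncomputable def rectIntegral (f : ℂ → ℂ) (a b y₁ y₂ : ℝ) : ℂ :=
  (∫ x : ℝ in a..b, f (x + y₁ * Complex.I)) - (∫ x : ℝ in a..b, f (x + y₂ * Complex.I)) +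
    Complex.I * (∫ y : ℝ in y₁..y₂, f (b + y * Complex.I)) -
    Complex.I * ∫ y : ℝ in y₁..y₂, f (a + y * Complex.I)

lemma rectIntegral_eq_zero {f : ℂ → ℂ} {a b y₁ y₂ : ℝ}
    (hf : DifferentiableOn ℂ f ([[a, b]] ×ℂ [[y₁, y₂]])) : rectIntegral f a b y₁ y₂ = 0 := by
  have := Complex.integral_boundary_rect_eq_zero_of_differentiableOn f ⟨a, y₁⟩ ⟨b, y₂⟩ hf
  simpa [rectIntegral] using this

lemma log_I_mul {u : ℂ} (hu : 0 < u.re) :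
    Complex.log (Complex.I * u) = Complex.log u + Real.pi / 2 * Complex.I := by
  have hu0 : u ≠ 0 := by rintro rfl; simp at hu
  have h := abs_lt.1 (Complex.abs_arg_lt_pi_div_two_iff.2 (Or.inl hu))
  rw [Complex.log_mul Complex.I_ne_zero hu0, Complex.log_I]
  · ring
  · rw [Complex.arg_I]
    constructor <;> linarith [Real.pi_pos]

lemma log_neg_I_mul {u : ℂ} (hu : 0 < u.re) :
    Complex.log (-Complex.I * u) = Complex.log u - Real.pi / 2 * Complex.I := by
  have hu0 : u ≠ 0 := by rintro rfl; simp at hu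
  have h := abs_lt.1 (Complex.abs_arg_lt_pi_div_two_iff.2 (Or.inl hu))
  rw [Complex.log_mul (neg_ne_zero.2 Complex.I_ne_zero) hu0, Complex.log_neg_I]
  · ring
  · rw [Complex.arg_neg_I]
    constructor <;> linarith [Real.pi_pos]

/-- The factor `k` rotates the segment off the branch cut and cancels in the logarithmic derivative.
-/
lemma integral_affine_inv {p d k : ℂ} {s t : ℝ} (hk : k ≠ 0)
    (h : ∀ x ∈ [[s, t]], k * (p + x * d) ∈ Complex.slitPlane) :
    d * ∫ x : ℝ in s..t, (p + x * d)⁻¹ =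
      Complex.log (k * (p + t * d)) - Complex.log (k * (p + s * d)) := by
  rw [← intervalIntegral.integral_const_mul]
  have hne : ∀ x ∈ [[s, t]], p + x * d ≠ 0 := fun x hx h0 => by
    have := h x hx
    rw [h0, mul_zero] at this
    exact Complex.slitPlane_ne_zero this rfl
  refine intervalIntegral.integral_eq_sub_of_hasDerivAt
    (f := fun x : ℝ => Complex.log (k * (p + x * d))) (fun x hx => ?_) ?_
  · have h1 : HasDerivAt (fun x : ℝ => k * (p + x * d)) (k * d) x := by
      have h2 := ((hasDerivAt_id x).ofReal_comp.mul_const d).const_add p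
      simpa using h2.const_mul k
    have h3 := h1.clog_real (h x hx)
    rwa [mul_div_mul_left _ _ hk, div_eq_mul_inv] at h3
  · refine ContinuousOn.intervalIntegrable ?_
    refine continuousOn_const.mul (ContinuousOn.inv₀ (by fun_prop) hne)

/-- The rotations `i, -i, 1, -1` carry the four sides into the right half plane, where the logarithm
is an antiderivative. At each corner the two branches differ by `iπ/2`, and the four corners add up
to `2πi`. -/
lemma rectIntegral_inv {a b y₁ y₂ : ℝ} {ω : ℂ} (ha : a < ω.re) (hb : ω.re < b)
    (h₁ : y₁ < ω.im) (h₂ : ω.im < y₂) :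
    rectIntegral (fun w => (w - ω)⁻¹) a b y₁ y₂ = 2 * Real.pi * Complex.I := by
  have e1 := integral_affine_inv (p := y₁ * Complex.I - ω) (d := 1) (k := Complex.I) (s := a)
    (t := b) Complex.I_ne_zero (fun x _ => Or.inl (by simp; linarith))
  have e2 := integral_affine_inv (p := y₂ * Complex.I - ω) (d := 1) (k := -Complex.I) (s := a)
    (t := b) (neg_ne_zero.2 Complex.I_ne_zero) (fun x _ => Or.inl (by simp; linarith))
  have e3 := integral_affine_inv (p := b - ω) (d := Complex.I) (k := 1) (s := y₁)
    (t := y₂) one_ne_zero (fun x _ => Or.inl (by simp; linarith))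
  have e4 := integral_affine_inv (p := a - ω) (d := Complex.I) (k := -1) (s := y₁)
    (t := y₂) (by simp) (fun x _ => Or.inl (by simp; linarith))
  have l1 := log_I_mul (u := b + y₁ * Complex.I - ω) (by simp; linarith)
  have l2 := log_neg_I_mul (u := b + y₂ * Complex.I - ω) (by simp; linarith)
  have l3 := log_I_mul (u := -(a + y₂ * Complex.I - ω)) (by simp; linarith)
  have l4 := log_neg_I_mul (u := -(a + y₁ * Complex.I - ω)) (by simp; linarith)
  have i1 : ∫ x : ℝ in a..b, (x + y₁ * Complex.I - ω)⁻¹ =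
      1 * ∫ x : ℝ in a..b, (y₁ * Complex.I - ω + x * 1)⁻¹ := by
    rw [one_mul]; congr 1; ext x; congr 1; ring
  have i2 : ∫ x : ℝ in a..b, (x + y₂ * Complex.I - ω)⁻¹ =
      1 * ∫ x : ℝ in a..b, (y₂ * Complex.I - ω + x * 1)⁻¹ := by
    rw [one_mul]; congr 1; ext x; congr 1; ring
  have i3 : ∫ y : ℝ in y₁..y₂, (b + y * Complex.I - ω)⁻¹ =
      ∫ y : ℝ in y₁..y₂, (b - ω + y * Complex.I)⁻¹ := by
    congr 1; ext x; congr 1; ring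
  have i4 : ∫ y : ℝ in y₁..y₂, (a + y * Complex.I - ω)⁻¹ =
      ∫ y : ℝ in y₁..y₂, (a - ω + y * Complex.I)⁻¹ := by
    congr 1; ext x; congr 1; ring
  rw [rectIntegral, i1, i2, i3, i4, e1, e2, e3, e4]
  have r1 : y₁ * Complex.I - ω + b * 1 = b + y₁ * Complex.I - ω := by ring
  have r2 : y₂ * Complex.I - ω + b * 1 = b + y₂ * Complex.I - ω := by ring
  have r3 : Complex.I * (y₁ * Complex.I - ω + a * 1) =
    -Complex.I * -(a + y₁ * Complex.I - ω) := by ring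
  have r4 : -Complex.I * (y₂ * Complex.I - ω + a * 1) =
    Complex.I * -(a + y₂ * Complex.I - ω) := by ring
  have r5 : 1 * (b - ω + y₁ * Complex.I) = b + y₁ * Complex.I - ω := by ring
  have r6 : 1 * (b - ω + y₂ * Complex.I) = b + y₂ * Complex.I - ω := by ring
  have r7 : -1 * (a - ω + y₁ * Complex.I) = -(a + y₁ * Complex.I - ω) := by ring
  have r8 : -1 * (a - ω + y₂ * Complex.I) = -(a + y₂ * Complex.I - ω) := by ring
  rw [r1, r2, r3, r4, r5, r6, r7, r8, l1, l2, l3, l4]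
  ring

lemma rectIntegral_congr {f g : ℂ → ℂ} {a b y₁ y₂ : ℝ} {ω : ℂ} (ha : a < ω.re) (hb : ω.re < b)
    (h₁ : y₁ < ω.im) (h₂ : ω.im < y₂) (h : ∀ w ≠ ω, f w = g w) :
    rectIntegral f a b y₁ y₂ = rectIntegral g a b y₁ y₂ := by
  have hre : ∀ w : ℂ, w.re ≠ ω.re → f w = g w := fun w hw => h w fun e => hw (by rw [e])
  have him : ∀ w : ℂ, w.im ≠ ω.im → f w = g w := fun w hw => h w fun e => hw (by rw [e])
  unfold rectIntegral
  congr 1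
  · congr 1
    · congr 1
      · congr 1; ext x; exact him _ (by simpa using h₁.ne)
      · congr 1; ext x; exact him _ (by simpa using h₂.ne')
    · congr 2; ext x; exact hre _ (by simpa using hb.ne')
  · congr 2; ext x; exact hre _ (by simpa using ha.ne)

lemma rectIntegral_add {f g : ℂ → ℂ} {a b y₁ y₂ : ℝ} {ω : ℂ} (ha : a < ω.re) (hb : ω.re < b)
    (h₁ : y₁ < ω.im) (h₂ : ω.im < y₂)
    (hf : ContinuousOn f (([[a, b]] ×ℂ [[y₁, y₂]]) \ {ω}))
    (hg : ContinuousOn g (([[a, b]] ×ℂ [[y₁, y₂]]) \ {ω})) :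
    rectIntegral (fun w => f w + g w) a b y₁ y₂ =
      rectIntegral f a b y₁ y₂ + rectIntegral g a b y₁ y₂ := by
  have hor : ∀ {k : ℂ → ℂ}, ContinuousOn k (([[a, b]] ×ℂ [[y₁, y₂]]) \ {ω}) →
      ∀ y ∈ [[y₁, y₂]], y ≠ ω.im →
      IntervalIntegrable (fun x : ℝ => k (x + y * Complex.I)) volume a b := by
    intro k hk y hy hne
    refine ContinuousOn.intervalIntegrable (hk.comp (by fun_prop) fun x hx => ⟨?_, ?_⟩)
    · simpa [Complex.mem_reProdIm] using ⟨hx, hy⟩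
    · intro e
      rw [mem_singleton_iff] at e
      exact hne (by simpa using congrArg Complex.im e)
  have ver : ∀ {k : ℂ → ℂ}, ContinuousOn k (([[a, b]] ×ℂ [[y₁, y₂]]) \ {ω}) →
      ∀ x ∈ [[a, b]], x ≠ ω.re →
      IntervalIntegrable (fun y : ℝ => k (x + y * Complex.I)) volume y₁ y₂ := by
    intro k hk x hx hne
    refine ContinuousOn.intervalIntegrable (hk.comp (by fun_prop) fun y hy => ⟨?_, ?_⟩)
    · simpa [Complex.mem_reProdIm] using ⟨hx, hy⟩
    · intro e
      rw [mem_singleton_iff] at e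
      exact hne (by simpa using congrArg Complex.re e)
  have m1 : a ∈ [[a, b]] := left_mem_uIcc
  have m2 : b ∈ [[a, b]] := right_mem_uIcc
  have m3 : y₁ ∈ [[y₁, y₂]] := left_mem_uIcc
  have m4 : y₂ ∈ [[y₁, y₂]] := right_mem_uIcc
  unfold rectIntegral
  rw [intervalIntegral.integral_add (hor hf _ m3 h₁.ne) (hor hg _ m3 h₁.ne),
    intervalIntegral.integral_add (hor hf _ m4 h₂.ne') (hor hg _ m4 h₂.ne'),
    intervalIntegral.integral_add (ver hf _ m1 ha.ne) (ver hg _ m1 ha.ne),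
    intervalIntegral.integral_add (ver hf _ m2 hb.ne') (ver hg _ m2 hb.ne')]
  ring

/-- Cauchy's integral formula for a rectangle. -/
lemma rectIntegral_div_sub {q : ℂ → ℂ} {a b y₁ y₂ : ℝ} {ω : ℂ} (ha : a < ω.re) (hb : ω.re < b)
    (h₁ : y₁ < ω.im) (h₂ : ω.im < y₂)
    (hq : DifferentiableOn ℂ q ([[a, b]] ×ℂ [[y₁, y₂]])) :
    rectIntegral (fun w => q w / (w - ω)) a b y₁ y₂ = 2 * Real.pi * Complex.I * q ω := by
  have hab : a ≤ b := (ha.trans hb).le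
  have hyy : y₁ ≤ y₂ := (h₁.trans h₂).le
  have hnhds : ([[a, b]] ×ℂ [[y₁, y₂]]) ∈ 𝓝 ω := by
    rw [← mem_interior_iff_mem_nhds, Complex.interior_reProdIm, uIcc_of_le hab, uIcc_of_le hyy,
      interior_Icc, interior_Icc]
    exact ⟨⟨ha, hb⟩, h₁, h₂⟩
  have hd : DifferentiableOn ℂ (dslope q ω) ([[a, b]] ×ℂ [[y₁, y₂]]) :=
    (Complex.differentiableOn_dslope hnhds).2 hq
  -- The difference quotient of `q` at `ω` is holomorphic across `ω`, so only `q(ω) / (w - ω)`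
  -- contributes. The boundary avoids `ω`, so conventional values there are harmless.
  rw [rectIntegral_congr (g := fun w => dslope q ω w + q ω * (w - ω)⁻¹) ha hb h₁ h₂,
    rectIntegral_add ha hb h₁ h₂ (hd.continuousOn.mono sdiff_subset), rectIntegral_eq_zero hd]
  · have : rectIntegral (fun w => q ω * (w - ω)⁻¹) a b y₁ y₂ =
        q ω * rectIntegral (fun w => (w - ω)⁻¹) a b y₁ y₂ := by
      simp only [rectIntegral, intervalIntegral.integral_const_mul]
      ring
    rw [this, rectIntegral_inv ha hb h₁ h₂]
    ring
  · exact continuousOn_const.mul (ContinuousOn.inv₀ (by fun_prop)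
      fun w hw => sub_ne_zero.2 fun e => hw.2 e)
  · intro w hw
    have := sub_ne_zero.2 hw
    rw [dslope_of_ne _ hw, slope_def_field]
    field_simp
    ring

/-! ### Half strips, the residue at `log ζ`, and the tail integral -/

/-- A constant rectangle integral, passed to the limit of a half strip. -/
lemma integral_half_strip {Φ : ℂ → ℂ} {ρ y₁ y₂ K δ T₀ : ℝ} {V : ℂ} (h₁₂ : y₁ ≤ y₂) (hδ : 0 < δ)
    (hc₁ : ContinuousOn (fun u : ℝ => Φ (u + y₁ * Complex.I)) (Ici ρ))
    (hc₂ : ContinuousOn (fun u : ℝ => Φ (u + y₂ * Complex.I)) (Ici ρ))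
    (hb : ∀ w : ℂ, T₀ ≤ w.re → w.im ∈ Icc y₁ y₂ → ‖Φ w‖ ≤ K * Real.exp (-δ * w.re))
    (hV : ∀ T : ℝ, T₀ ≤ T → rectIntegral Φ ρ T y₁ y₂ = V) :
    IntegrableOn (fun u : ℝ => Φ (u + y₁ * Complex.I)) (Ioi ρ) ∧
    IntegrableOn (fun u : ℝ => Φ (u + y₂ * Complex.I)) (Ioi ρ) ∧
    (∫ u in Ioi ρ, Φ (u + y₁ * Complex.I)) - (∫ u in Ioi ρ, Φ (u + y₂ * Complex.I)) =
      V + Complex.I * ∫ y in y₁..y₂, Φ (ρ + y * Complex.I) := by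
  have hint : ∀ y ∈ Icc y₁ y₂, ContinuousOn (fun u : ℝ => Φ (u + y * Complex.I)) (Ici ρ) →
      IntegrableOn (fun u : ℝ => Φ (u + y * Complex.I)) (Ioi ρ) := by
    intro y hy hcont
    have h1 := integrable_of_isBigO_exp_neg hδ hcont.norm
      (Asymptotics.IsBigO.of_bound K (by
        filter_upwards [eventually_ge_atTop T₀] with u hu
        simpa using hb (u + y * Complex.I) (by simpa using hu) (by simpa using hy)))
    exact (integrable_norm_iff ((hcont.mono Ioi_subset_Ici_self).aestronglyMeasurable
      measurableSet_Ioi)).1 h1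
  have i1 := hint y₁ (left_mem_Icc.2 h₁₂) hc₁
  have i2 := hint y₂ (right_mem_Icc.2 h₁₂) hc₂
  refine ⟨i1, i2, ?_⟩
  have t1 := intervalIntegral_tendsto_integral_Ioi ρ i1 tendsto_id
  have t2 := intervalIntegral_tendsto_integral_Ioi ρ i2 tendsto_id
  have t3 : Tendsto (fun T : ℝ => ∫ y in y₁..y₂, Φ (T + y * Complex.I)) atTop (𝓝 0) := by
    have hexp : Tendsto (fun T : ℝ => K * Real.exp (-δ * T) * |y₂ - y₁|) atTop (𝓝 0) := by
      have : Tendsto (fun T : ℝ => Real.exp (-δ * T)) atTop (𝓝 0) :=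
        Real.tendsto_exp_atBot.comp (tendsto_id.const_mul_atTop_of_neg (neg_lt_zero.2 hδ))
      simpa using (this.const_mul K).mul_const |y₂ - y₁|
    refine squeeze_zero_norm' ?_ hexp
    filter_upwards [eventually_ge_atTop T₀] with T hT
    refine intervalIntegral.norm_integral_le_of_norm_le_const fun y hy => ?_
    rw [uIoc_of_le h₁₂] at hy
    simpa using hb (T + y * Complex.I) (by simpa using hT) (by simpa using ⟨hy.1.le, hy.2⟩)
  have hlim := ((t1.sub t2).add (t3.const_mul Complex.I)).sub_const
    (Complex.I * ∫ y in y₁..y₂, Φ (ρ + y * Complex.I))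
  have hconst : Tendsto (fun T : ℝ => rectIntegral Φ ρ T y₁ y₂) atTop (𝓝 V) :=
    tendsto_const_nhds.congr' (by
      filter_upwards [eventually_ge_atTop T₀] with T hT
      exact (hV T hT).symm)
  have := tendsto_nhds_unique hlim hconst
  rw [← this]
  ring

/-- Here `e^w` lies in the closed upper half plane, while `ζ` lies strictly below it. -/
lemma exp_ne_of_sin_nonneg {w ζ : ℂ} (hζ : ζ.im < 0) (hw : 0 ≤ Real.sin w.im) :
    ζ - Complex.exp w ≠ 0 := by
  intro h
  have h1 := congrArg Complex.im (sub_eq_zero.1 h)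
  rw [Complex.exp_im] at h1
  have := mul_nonneg (Real.exp_pos w.re).le hw
  linarith

/-- The threshold `log (‖ζ‖ + 1)` forces the denominator to have modulus at least `1`. -/
lemma norm_div_sub_exp_le {F : ℂ → ℂ} {w ζ : ℂ} {C δ : ℝ}
    (hF : ‖F w‖ ≤ C * Real.exp (-δ * w.re)) (hw : Real.log (‖ζ‖ + 1) ≤ w.re) :
    ‖F w / (ζ - Complex.exp w)‖ ≤ C * Real.exp (-δ * w.re) := by
  have h1 : ‖ζ‖ + 1 ≤ Real.exp w.re := (Real.log_le_iff_le_exp (by positivity)).1 hw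
  have h2 : 1 ≤ ‖ζ - Complex.exp w‖ := by
    have := norm_sub_norm_le (Complex.exp w) ζ
    rw [Complex.norm_exp, norm_sub_rev] at this
    linarith
  rw [norm_div]
  exact (div_le_self (norm_nonneg _) h2).trans hF

section HalfStrip

variable {F : ℂ → ℂ} {ρ₀ ρ C δ : ℝ} {ζ : ℂ}

lemma continuousOn_line_div_sub_exp (hF : DifferentiableOn ℂ F {w | ρ₀ < w.re}) (hρ : ρ₀ < ρ)
    (hζ : ζ.im < 0) {y : ℝ} (hy : Real.sin y = 0) :
    ContinuousOn (fun u : ℝ => F (u + y * Complex.I) /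
      (ζ - Complex.exp (u + y * Complex.I))) (Ici ρ) := by
  refine ContinuousOn.div (hF.continuousOn.comp (by fun_prop) fun u hu => ?_) (by fun_prop)
    fun u hu => exp_ne_of_sin_nonneg hζ (by simp [hy])
  simpa using hρ.trans_le hu

lemma upper_half_strip (hF : DifferentiableOn ℂ F {w | ρ₀ < w.re}) (hρ : ρ₀ < ρ) (hδ : 0 < δ)
    (hb : ∀ w : ℂ, ρ ≤ w.re → ‖F w‖ ≤ C * Real.exp (-δ * w.re)) (hζ : ζ.im < 0) :
    IntegrableOn (fun u : ℝ => F u / (ζ - Complex.exp u)) (Ioi ρ) ∧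
    IntegrableOn (fun u : ℝ => F (u + Real.pi * Complex.I) /
      (ζ - Complex.exp (u + Real.pi * Complex.I))) (Ioi ρ) ∧
    (∫ u : ℝ in Ioi ρ, F u / (ζ - Complex.exp u)) -
      (∫ u : ℝ in Ioi ρ, F (u + Real.pi * Complex.I) /
        (ζ - Complex.exp (u + Real.pi * Complex.I))) =
      Complex.I * ∫ y in 0..Real.pi, F (ρ + y * Complex.I) /
        (ζ - Complex.exp (ρ + y * Complex.I)) := by
  have key := integral_half_strip (Φ := fun w => F w / (ζ - Complex.exp w)) (ρ := ρ) (y₁ := 0)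
    (y₂ := Real.pi) (K := C) (T₀ := max ρ (Real.log (‖ζ‖ + 1))) (V := 0) Real.pi_pos.le hδ
    (continuousOn_line_div_sub_exp hF hρ hζ Real.sin_zero)
    (continuousOn_line_div_sub_exp hF hρ hζ Real.sin_pi)
    (fun w hw _ => norm_div_sub_exp_le (hb w ((le_max_left _ _).trans hw))
      ((le_max_right _ _).trans hw)) ?_
  · simpa using key
  · intro T hT
    refine rectIntegral_eq_zero (DifferentiableOn.div (hF.mono fun w hw => ?_)
      (by fun_prop) fun w hw => exp_ne_of_sin_nonneg hζ ?_)
    · have h1 := hw.1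
      rw [mem_preimage, uIcc_of_le ((le_max_left _ _).trans hT)] at h1
      exact hρ.trans_le h1.1
    · have h1 := hw.2
      rw [mem_preimage, uIcc_of_le Real.pi_pos.le] at h1
      exact Real.sin_nonneg_of_mem_Icc h1

/-- `exp` is injective modulo `2πi` and has no critical point. Thus `ζ - e^w` has only the simple
zero `log ζ` in the lower strip, and Cauchy's formula applies to `-F / dslope exp`. -/
lemma dslope_exp_ne_zero {ω w : ℂ} (h : |w.im - ω.im| < 2 * Real.pi) :
    dslope Complex.exp ω w ≠ 0 := by
  by_cases hw : w = ω
  · subst hw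
    simp [dslope_same]
  · rw [dslope_of_ne _ hw, slope_def_field]
    refine div_ne_zero (fun h0 => hw ?_) (sub_ne_zero.2 hw)
    obtain ⟨n, hn⟩ := Complex.exp_eq_exp_iff_exists_int.1 (sub_eq_zero.1 h0)
    have him := congrArg Complex.im hn
    simp only [Complex.add_im, Complex.mul_im, Complex.intCast_re, Complex.intCast_im,
      Complex.mul_re, Complex.I_re, Complex.I_im, Complex.ofReal_re, Complex.ofReal_im,
      Complex.re_ofNat, Complex.im_ofNat] at him
    have hn0 : n = 0 := by
      rw [him] at h
      have h2 : |(n : ℝ)| * (2 * Real.pi) < 1 * (2 * Real.pi) := by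
        rw [← abs_of_pos Real.two_pi_pos, ← abs_mul, abs_of_pos Real.two_pi_pos]
        convert h using 1
        · congr 1; ring
        · ring
      have h3 := lt_of_mul_lt_mul_right h2 Real.two_pi_pos.le
      exact Int.abs_lt_one_iff.1 (by exact_mod_cast h3)
    rw [hn, hn0]
    simp

/-- The bound `e^ρ < ‖ζ‖` places the pole `log ζ` inside the half strip; its residue produces the
non-integer powers of `ζ`. -/
lemma lower_half_strip (hF : DifferentiableOn ℂ F {w | ρ₀ < w.re}) (hρ : ρ₀ < ρ) (hδ : 0 < δ)
    (hb : ∀ w : ℂ, ρ ≤ w.re → ‖F w‖ ≤ C * Real.exp (-δ * w.re)) (hζ : ζ.im < 0)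
    (hζρ : Real.exp ρ < ‖ζ‖) :
    IntegrableOn (fun u : ℝ => F u / (ζ - Complex.exp u)) (Ioi ρ) ∧
    IntegrableOn (fun u : ℝ => F (u - Real.pi * Complex.I) /
      (ζ - Complex.exp (u - Real.pi * Complex.I))) (Ioi ρ) ∧
    (∫ u : ℝ in Ioi ρ, F u / (ζ - Complex.exp u)) -
      (∫ u : ℝ in Ioi ρ, F (u - Real.pi * Complex.I) /
        (ζ - Complex.exp (u - Real.pi * Complex.I))) =
      2 * Real.pi * Complex.I * (F (Complex.log ζ) / ζ) -
      Complex.I * ∫ y in (-Real.pi)..0, F (ρ + y * Complex.I) /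
        (ζ - Complex.exp (ρ + y * Complex.I)) := by
  have hζ0 : ζ ≠ 0 := by rintro rfl; simp at hζ
  have hπ := Real.pi_pos
  have hre : ρ < (Complex.log ζ).re := by
    rw [Complex.log_re]
    exact (Real.lt_log_iff_exp_lt (norm_pos_iff.2 hζ0)).2 hζρ
  have him : (Complex.log ζ).im < 0 := by
    rw [Complex.log_im]
    exact Complex.arg_neg_iff.2 hζ
  have him' : -Real.pi < (Complex.log ζ).im := by
    rw [Complex.log_im]
    exact Complex.neg_pi_lt_arg ζ
  have key := integral_half_strip (Φ := fun w => F w / (ζ - Complex.exp w)) (ρ := ρ)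
    (y₁ := -Real.pi) (y₂ := 0) (K := C) (T₀ := max ρ (Real.log (‖ζ‖ + 1)))
    (V := 2 * Real.pi * Complex.I * (-F (Complex.log ζ) / ζ)) (by linarith) hδ
    (continuousOn_line_div_sub_exp hF hρ hζ (by simp))
    (continuousOn_line_div_sub_exp hF hρ hζ Real.sin_zero)
    (fun w hw _ => norm_div_sub_exp_le (hb w ((le_max_left _ _).trans hw))
      ((le_max_right _ _).trans hw)) ?_
  · obtain ⟨k1, k2, k3⟩ := key
    simp only [Complex.ofReal_zero, zero_mul, add_zero, Complex.ofReal_neg, neg_mul,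
      ← sub_eq_add_neg] at k1 k2 k3
    refine ⟨k2, k1, ?_⟩
    linear_combination -k3
  · intro T hT
    have hT1 : (Complex.log ζ).re < T := by
      rw [Complex.log_re]
      refine lt_of_lt_of_le ?_ ((le_max_right _ _).trans hT)
      exact Real.log_lt_log (norm_pos_iff.2 hζ0) (by linarith)
    have hρT := (le_max_left _ _).trans hT
    set ω := Complex.log ζ with hω
    have hexp : Complex.exp ω = ζ := Complex.exp_log hζ0
    have hq := rectIntegral_div_sub (q := fun w => -F w / dslope Complex.exp ω w)
      hre hT1 him' him ?_
    · simp only [dslope_same, Complex.deriv_exp, hexp] at hq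
      rw [← hq]
      refine rectIntegral_congr hre hT1 him' him fun w hw => ?_
      have hw' := sub_ne_zero.2 hw
      rw [dslope_of_ne _ hw, slope_def_field, hexp, div_div, div_mul_cancel₀ _ hw', neg_div,
        ← div_neg, neg_sub]
    · refine DifferentiableOn.div (hF.mono fun w hw => ?_).neg ?_ fun w hw => ?_
      · have h1 := hw.1
        rw [mem_preimage, uIcc_of_le hρT] at h1
        exact hρ.trans_le h1.1
      · exact ((Complex.differentiableOn_dslope univ_mem).2
          Complex.differentiable_exp.differentiableOn).mono (subset_univ _)
      · have h1 := hw.2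
        rw [mem_preimage, uIcc_of_le (by linarith)] at h1
        refine dslope_exp_ne_zero ?_
        rw [abs_lt]
        constructor <;> linarith [h1.1, h1.2]

open ComplexConjugate in
/-- The Cauchy transform of a tail density `Im (e^{-w} F(w))`, `x = e^w`. -/
lemma integral_tail (hF : DifferentiableOn ℂ F {w | ρ₀ < w.re}) (hρ : ρ₀ < ρ) (hδ : 0 < δ)
    (hb : ∀ w : ℂ, ρ ≤ w.re → ‖F w‖ ≤ C * Real.exp (-δ * w.re)) (hζ : ζ.im < 0)
    (hζρ : Real.exp ρ < ‖ζ‖) {D : ℝ → ℝ}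
    (hD₁ : ∀ u : ℝ, ρ < u → D (Real.exp u) = Real.exp (-u) * (F u).im)
    (hD₂ : ∀ u : ℝ, ρ < u → D (-Real.exp u) =
      -(Real.exp (-u) * (F (u - Real.pi * Complex.I)).im)) :
    ∫ x : ℝ in {x : ℝ | Real.exp ρ ≤ |x|}, D x / (ζ - x) =
      Real.pi * (F (Complex.log ζ) / ζ) -
      (∫ y in (-Real.pi)..0, F (ρ + y * Complex.I) / (ζ - Complex.exp (ρ + y * Complex.I))) / 2 -
      (∫ y in 0..Real.pi, conj (F (conj (ρ + y * Complex.I))) /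
        (ζ - Complex.exp (ρ + y * Complex.I))) / 2 := by
  -- The reflected function is again holomorphic with the same decay. It turns `Im F`, which is not
  -- holomorphic, into a difference of two holomorphic boundary values.
  have hF' : DifferentiableOn ℂ (fun w => conj (F (conj w))) {w | ρ₀ < w.re} := by
    intro w hw
    have h1 : DifferentiableAt ℂ F (conj w) :=
      (hF (conj w) (by simpa using hw)).differentiableAt
        ((isOpen_lt continuous_const Complex.continuous_re).mem_nhds (by simpa using hw))
    have h2 := h1.conj_conj
    rw [Complex.conj_conj] at h2
    exact h2.differentiableWithinAt
  have hb' : ∀ w : ℂ, ρ ≤ w.re → ‖conj (F (conj w))‖ ≤ C * Real.exp (-δ * w.re) := by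
    intro w hw
    rw [RCLike.norm_conj]
    simpa using hb (conj w) (by simpa using hw)
  obtain ⟨l1, l2, l3⟩ := lower_half_strip hF hρ hδ hb hζ hζρ
  obtain ⟨u1, u2, u3⟩ := upper_half_strip hF' hρ hδ hb' hζ
  have hset : ({x : ℝ | Real.exp ρ ≤ |x|} : Set ℝ) =ᵐ[volume]
      (Real.exp '' Ioi ρ ∪ (fun u => -Real.exp u) '' Ioi ρ : Set ℝ) := by
    filter_upwards [compl_mem_ae_iff.2 (measure_singleton (Real.exp ρ)),
      compl_mem_ae_iff.2 (measure_singleton (-Real.exp ρ))] with x hx₁ hx₂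
    have hx₁' : x ≠ Real.exp ρ := hx₁
    have hx₂' : x ≠ -Real.exp ρ := hx₂
    have h0 := Real.exp_pos ρ
    refine propext ⟨fun h => ?_, ?_⟩
    · rcases le_abs.1 (h : Real.exp ρ ≤ |x|) with h | h
      · have hlt := lt_of_le_of_ne h hx₁'.symm
        exact Or.inl ⟨Real.log x, (Real.lt_log_iff_exp_lt (h0.trans hlt)).2 hlt,
          Real.exp_log (h0.trans hlt)⟩
      · have hlt : Real.exp ρ < -x := lt_of_le_of_ne h fun e => hx₂' (by rw [e, neg_neg])
        refine Or.inr ⟨Real.log (-x), (Real.lt_log_iff_exp_lt (h0.trans hlt)).2 hlt, ?_⟩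
        simp only [Real.exp_log (h0.trans hlt), neg_neg]
    · rintro (⟨u, hu, rfl⟩ | ⟨u, hu, rfl⟩)
      · change Real.exp ρ ≤ |Real.exp u|
        rw [abs_of_pos (Real.exp_pos u)]
        exact Real.exp_le_exp.2 (le_of_lt hu)
      · change Real.exp ρ ≤ |-Real.exp u|
        rw [abs_neg, abs_of_pos (Real.exp_pos u)]
        exact Real.exp_le_exp.2 (le_of_lt hu)
  have hdisj : Disjoint (Real.exp '' Ioi ρ) ((fun u => -Real.exp u) '' Ioi ρ) := by
    rw [Set.disjoint_left]
    rintro _ ⟨u, -, rfl⟩ ⟨v, -, hv⟩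
    have := Real.exp_pos u
    have := Real.exp_pos v
    simp only at hv
    linarith
  have hconj : ∀ z : ℂ, (z.im : ℂ) = (z - conj z) / (2 * Complex.I) := fun z => by
    rw [Complex.im_eq_sub_conj]
  have e1 : EqOn (fun u : ℝ => |Real.exp u| • (D (Real.exp u) / (ζ - (Real.exp u : ℝ)) : ℂ))
      (fun u : ℝ => (F u / (ζ - Complex.exp u) - conj (F (conj (u : ℂ))) /
        (ζ - Complex.exp u)) / (2 * Complex.I)) (Ioi ρ) := by
    intro u hu
    have h1 : (Real.exp u : ℂ) * Real.exp (-u) = 1 := by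
      rw [← Complex.ofReal_mul, ← Real.exp_add, add_neg_cancel, Real.exp_zero, Complex.ofReal_one]
    simp only [hD₁ u hu, abs_of_pos (Real.exp_pos u), Complex.real_smul, Complex.ofReal_mul,
      hconj, Complex.conj_ofReal, Complex.ofReal_exp] at h1 ⊢
    linear_combination ((F u - conj (F u)) / (2 * Complex.I) / (ζ - Complex.exp u)) * h1
  -- On the negative axis `F` is read on `Im w = -π` and its reflection on `Im w = π`; `e^w = -e^u`
  -- on both lines.
  have e2 : EqOn (fun u : ℝ => |-Real.exp u| • (D (-Real.exp u) / (ζ - (-Real.exp u : ℝ)) : ℂ))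
      (fun u : ℝ => (conj (F (conj (u + Real.pi * Complex.I : ℂ))) /
        (ζ - Complex.exp (u + Real.pi * Complex.I)) - F (u - Real.pi * Complex.I) /
        (ζ - Complex.exp (u - Real.pi * Complex.I))) / (2 * Complex.I)) (Ioi ρ) := by
    intro u hu
    have h1 : (Real.exp u : ℂ) * Real.exp (-u) = 1 := by
      rw [← Complex.ofReal_mul, ← Real.exp_add, add_neg_cancel, Real.exp_zero, Complex.ofReal_one]
    have h2 : Complex.exp (u + Real.pi * Complex.I) = -Complex.exp u := by
      rw [Complex.exp_add, Complex.exp_pi_mul_I, mul_neg_one]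
    have h3 : Complex.exp (u - Real.pi * Complex.I) = -Complex.exp u := by
      rw [Complex.exp_sub, Complex.exp_pi_mul_I, div_neg, div_one]
    have h4 : conj (u + Real.pi * Complex.I : ℂ) = u - Real.pi * Complex.I := by
      simp [sub_eq_add_neg]
    simp only [hD₂ u hu, abs_neg, abs_of_pos (Real.exp_pos u), Complex.real_smul,
      Complex.ofReal_mul, Complex.ofReal_neg, hconj, h2, h3, h4, Complex.ofReal_exp] at h1 ⊢
    linear_combination (-(F (u - Real.pi * Complex.I) - conj (F (u - Real.pi * Complex.I))) /
      (2 * Complex.I) / (ζ - -Complex.exp u)) * h1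
  have d1 : ∀ u ∈ Ioi ρ, HasDerivWithinAt Real.exp (Real.exp u) (Ioi ρ) u := fun u _ =>
    (Real.hasDerivAt_exp u).hasDerivWithinAt
  have d2 : ∀ u ∈ Ioi ρ, HasDerivWithinAt (fun u => -Real.exp u) (-Real.exp u) (Ioi ρ) u :=
    fun u _ => (Real.hasDerivAt_exp u).neg.hasDerivWithinAt
  have j1 : InjOn Real.exp (Ioi ρ) := Real.exp_injective.injOn
  have j2 : InjOn (fun u => -Real.exp u) (Ioi ρ) :=
    (neg_injective.comp Real.exp_injective).injOn
  have u1' : IntegrableOn (fun u : ℝ => conj (F (conj (u : ℂ))) / (ζ - Complex.exp u)) (Ioi ρ) :=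
    u1
  have i1 : IntegrableOn (fun x : ℝ => (D x / (ζ - x) : ℂ)) (Real.exp '' Ioi ρ) := by
    rw [integrableOn_image_iff_integrableOn_abs_deriv_smul measurableSet_Ioi d1 j1,
      integrableOn_congr_fun e1 measurableSet_Ioi]
    exact (l1.sub u1').div_const _
  have i2 : IntegrableOn (fun x : ℝ => (D x / (ζ - x) : ℂ))
      ((fun u => -Real.exp u) '' Ioi ρ) := by
    rw [integrableOn_image_iff_integrableOn_abs_deriv_smul measurableSet_Ioi d2 j2,
      integrableOn_congr_fun e2 measurableSet_Ioi]
    exact (u2.sub l2).div_const _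
  rw [setIntegral_congr_set hset, setIntegral_union hdisj
      (measurableSet_Ioi.image_of_continuousOn_injOn (by fun_prop) j2) i1 i2,
    integral_image_eq_integral_abs_deriv_smul measurableSet_Ioi d1 j1,
    integral_image_eq_integral_abs_deriv_smul measurableSet_Ioi d2 j2,
    setIntegral_congr_fun measurableSet_Ioi e1, setIntegral_congr_fun measurableSet_Ioi e2,
    integral_div, integral_div, integral_sub l1 u1', integral_sub u2 l2]
  rw [← add_div, div_eq_iff (mul_ne_zero two_ne_zero Complex.I_ne_zero)]
  -- The four line integrals regroup into the lower strip for `F` minus the upper strip for its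
  -- reflection.
  linear_combination l3 - u3

end HalfStrip

/-! ### Laurent expansion of the remainder terms -/

/-- Expansion of `∫ h / (ζ - k)` in powers of `1 / ζ` when `|k| ≤ R < |ζ|`. -/
lemma hasSum_integral_geometric {α : Type*} [MeasurableSpace α] {ν : Measure α} {h k : α → ℂ}
    {R : ℝ} (hh : Integrable h ν) (hk : AEStronglyMeasurable k ν) (hR : ∀ᵐ x ∂ν, ‖k x‖ ≤ R)
    (hR0 : 0 ≤ R) :
    (∀ n : ℕ, ‖∫ x, h x * k x ^ n ∂ν‖ ≤ (∫ x, ‖h x‖ ∂ν) * R ^ n) ∧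
    ∀ ζ : ℂ, R < ‖ζ‖ → HasSum (fun n : ℕ => (∫ x, h x * k x ^ n ∂ν) / ζ ^ (n + 1))
      (∫ x, h x / (ζ - k x) ∂ν) := by
  have hle : ∀ n : ℕ, ∀ᵐ x ∂ν, ‖h x * k x ^ n‖ ≤ ‖h x‖ * R ^ n := fun n => by
    filter_upwards [hR] with x hx
    rw [norm_mul, norm_pow]
    gcongr
  have hint : ∀ n : ℕ, Integrable (fun x => h x * k x ^ n) ν := fun n =>
    (hh.norm.mul_const (R ^ n)).mono' (hh.aestronglyMeasurable.mul (hk.pow n)) (hle n)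
  have hnorm : ∀ n : ℕ, ∫ x, ‖h x * k x ^ n‖ ∂ν ≤ (∫ x, ‖h x‖ ∂ν) * R ^ n := fun n => by
    rw [← integral_mul_const]
    exact integral_mono_ae (hint n).norm (hh.norm.mul_const _) (hle n)
  refine ⟨fun n => (norm_integral_le_integral_norm _).trans (hnorm n), fun ζ hζ => ?_⟩
  have hζ0 : 0 < ‖ζ‖ := hR0.trans_lt hζ
  have hζne : ζ ≠ 0 := norm_pos_iff.1 hζ0
  have hsum : Summable fun n : ℕ => ∫ x, ‖h x * k x ^ n / ζ ^ (n + 1)‖ ∂ν := by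
    have hgeo : Summable fun n : ℕ => ((∫ x, ‖h x‖ ∂ν) / ‖ζ‖) * (R / ‖ζ‖) ^ n :=
      (summable_geometric_of_lt_one (by positivity) ((div_lt_one hζ0).2 hζ)).mul_left _
    refine hgeo.of_nonneg_of_le (fun n => integral_nonneg fun x => norm_nonneg _) fun n => ?_
    simp only [norm_div, integral_div, norm_pow ζ]
    rw [div_pow, div_mul_div_comm, pow_succ']
    gcongr
    exact hnorm n
  have key := hasSum_integral_of_summable_integral_norm
    (F := fun (n : ℕ) x => h x * k x ^ n / ζ ^ (n + 1))
    (fun n => (hint n).div_const (ζ ^ (n + 1))) hsum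
  simp only [integral_div] at key
  have heq : ∫ x, h x / (ζ - k x) ∂ν = ∫ x, ∑' n : ℕ, h x * k x ^ n / ζ ^ (n + 1) ∂ν := by
    refine integral_congr_ae ?_
    filter_upwards [hR] with x hx
    have hlt : ‖k x / ζ‖ < 1 := by
      rw [norm_div, div_lt_one hζ0]
      exact hx.trans_lt hζ
    have hne : ζ - k x ≠ 0 := by
      intro h0
      rw [sub_eq_zero.1 h0] at hζ
      exact absurd hx (not_le.2 hζ)
    have h1 := ((hasSum_geometric_of_norm_lt_one hlt).mul_left (h x / ζ)).tsum_eq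
    rw [← div_eq_mul_inv, div_div, mul_sub, mul_div_cancel₀ _ hζne, mul_one] at h1
    rw [← h1]
    refine tsum_congr fun n => ?_
    rw [div_pow, div_mul_div_comm, pow_succ']
  rw [heq]
  exact key

/-! ### The tail density as an exponential series -/

/-- The function `w ↦ ∑ a_β e^{-βw}`, so that `e^{-w}` times it is `∑ a_β (1/x)^{β+1}` at
`x = e^w`. -/
noncomputable def expSeries (S : AddSubsemigroup ℝ) (a : PosPart S → ℂ) (w : ℂ) : ℂ :=
  ∑' β : PosPart S, a β * Complex.exp (-(β : ℝ) * w)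

/-- The inclusion of the positive part. -/
def PosPart.incl (S : AddSubsemigroup ℝ) (β : PosPart S) : S := ⟨β, β.2.1⟩

lemma PosPart.incl_injective (S : AddSubsemigroup ℝ) : Function.Injective (PosPart.incl S) :=
  fun _ _ h => Subtype.ext (Subtype.mk.inj h)

@[simp]
lemma PosPart.coe_incl (S : AddSubsemigroup ℝ) (β : PosPart S) :
    ((PosPart.incl S β : S) : ℝ) = (β : ℝ) := rfl

section Series

variable {S : AddSubsemigroup ℝ} {c r R : ℝ} {a : PosPart S → ℂ}

lemma summable_posPart_rpow (hS : IsExponentSet S c) {q : ℝ} (hq : 0 < q) (hcq : c * q < 1) :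
    Summable (fun β : PosPart S => q ^ (β : ℝ)) := by
  have h := (hS.summable_rpow hq hcq).comp_injective (PosPart.incl_injective S)
  simpa only [Function.comp_def, PosPart.coe_incl] using h

lemma norm_expSeries_term (ha : ∀ β : PosPart S, ‖a β‖ ≤ r ^ (β : ℝ)) (hr : 0 < r)
    (β : PosPart S) {σ : ℝ} {w : ℂ} (hw : σ ≤ w.re) :
    ‖a β * Complex.exp (-(β : ℝ) * w)‖ ≤ (r * Real.exp (-σ)) ^ (β : ℝ) := by
  rw [norm_mul, Complex.norm_exp, Real.mul_rpow hr.le (Real.exp_pos _).le, ← Real.exp_mul]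
  refine mul_le_mul (ha β) ?_ (Real.exp_pos _).le (Real.rpow_nonneg hr.le _)
  rw [Real.exp_le_exp]
  have := mul_le_mul_of_nonneg_left hw β.2.2.le
  simp
  linarith

lemma mul_exp_neg_lt_one (hS : IsExponentSet S c) (hr : 0 < r) {σ : ℝ}
    (hσ : Real.log (c * r) < σ) : c * (r * Real.exp (-σ)) < 1 := by
  have h1 := (Real.log_lt_iff_lt_exp (mul_pos hS.const_pos hr)).1 hσ
  rw [Real.exp_neg, ← mul_assoc, ← div_eq_mul_inv]
  exact (div_lt_one (Real.exp_pos _)).2 h1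

lemma summable_expSeries (hS : IsExponentSet S c) (ha : ∀ β : PosPart S, ‖a β‖ ≤ r ^ (β : ℝ))
    (hr : 0 < r) {w : ℂ} (hw : Real.log (c * r) < w.re) :
    Summable fun β : PosPart S => a β * Complex.exp (-(β : ℝ) * w) :=
  Summable.of_norm_bounded
    (summable_posPart_rpow hS (mul_pos hr (Real.exp_pos _)) (mul_exp_neg_lt_one hS hr hw))
    fun β => norm_expSeries_term ha hr β le_rfl

lemma differentiableOn_expSeries (hS : IsExponentSet S c)
    (ha : ∀ β : PosPart S, ‖a β‖ ≤ r ^ (β : ℝ)) (hr : 0 < r) :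
    DifferentiableOn ℂ (expSeries S a) {w | Real.log (c * r) < w.re} := by
  intro w hw
  obtain ⟨σ, h1, h2⟩ := exists_between (show Real.log (c * r) < w.re from hw)
  have hopen : IsOpen {w : ℂ | σ < w.re} := isOpen_lt continuous_const Complex.continuous_re
  have := Complex.differentiableOn_tsum_of_summable_norm (U := {w : ℂ | σ < w.re})
    (F := fun (β : PosPart S) w => a β * Complex.exp (-(β : ℝ) * w))
    (summable_posPart_rpow hS (mul_pos hr (Real.exp_pos _)) (mul_exp_neg_lt_one hS hr h1))
    (fun β => by fun_prop) hopen (fun β w hw => norm_expSeries_term ha hr β (le_of_lt hw))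
  exact ((this w h2).differentiableAt (hopen.mem_nhds h2)).differentiableWithinAt

/-- Every exponent is at least the smallest positive element `δ` of `S`, so each term is at most its
bound at `Re w = ρ` times `e^{-δ (Re w - ρ)}`. -/
lemma exists_norm_expSeries_le (hS : IsExponentSet S c)
    (ha : ∀ β : PosPart S, ‖a β‖ ≤ r ^ (β : ℝ)) (hr : 0 < r) {ρ : ℝ}
    (hρ : Real.log (c * r) < ρ) :
    ∃ C δ : ℝ, 0 < δ ∧ ∀ w : ℂ, ρ ≤ w.re →
      ‖expSeries S a w‖ ≤ C * Real.exp (-δ * w.re) := by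
  obtain ⟨δ, hδ, hmin⟩ := hS.exists_pos_le
  have hsum := summable_posPart_rpow hS (mul_pos hr (Real.exp_pos (-ρ)))
    (mul_exp_neg_lt_one hS hr hρ)
  refine ⟨(∑' β : PosPart S, (r * Real.exp (-ρ)) ^ (β : ℝ)) * Real.exp (δ * ρ), δ, hδ,
    fun w hw => ?_⟩
  rw [mul_assoc, ← Real.exp_add, ← tsum_mul_right]
  refine tsum_of_norm_bounded (hsum.mul_right _).hasSum fun β => ?_
  have h1 := norm_expSeries_term ha hr β (le_refl w.re)
  refine h1.trans ?_
  rw [Real.mul_rpow hr.le (Real.exp_pos _).le, Real.mul_rpow hr.le (Real.exp_pos _).le,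
    mul_assoc, ← Real.exp_mul, ← Real.exp_mul, ← Real.exp_add]
  refine mul_le_mul_of_nonneg_left (Real.exp_le_exp.2 ?_) (Real.rpow_nonneg hr.le _)
  have := hmin (PosPart.incl S β) β.2.2
  have h2 : δ ≤ (β : ℝ) := this
  nlinarith

lemma tailDensity_exp (hS : IsExponentSet S c) (ha : ∀ β : PosPart S, ‖a β‖ ≤ r ^ (β : ℝ))
    (hr : 0 < r) {u : ℝ} (hu : Real.log (c * r) < u) :
    tailDensity S a (Real.exp u) = Real.exp (-u) * (expSeries S a u).im := by
  have hs := summable_expSeries hS ha hr (w := (u : ℂ)) (by simpa using hu)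
  rw [tailDensity, expSeries, ← Complex.imCLM_apply, Complex.imCLM.map_tsum hs, ← tsum_mul_left]
  refine tsum_congr fun β => ?_
  rw [invPow, if_pos (Real.exp_pos u), ← Real.exp_mul, Complex.imCLM_apply,
    ← Complex.im_ofReal_mul]
  congr 1
  push_cast
  rw [mul_left_comm, ← Complex.exp_add]
  congr 2
  ring

/-- The factor `e^{i(β+1)π}` is `-e^{-β(-iπ)}`: the convention for negative `x` continues the power
through the lower half plane. This is why `G_μ` is expanded for `Im z < 0`. -/
lemma tailDensity_neg_exp (hS : IsExponentSet S c) (ha : ∀ β : PosPart S, ‖a β‖ ≤ r ^ (β : ℝ))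
    (hr : 0 < r) {u : ℝ} (hu : Real.log (c * r) < u) :
    tailDensity S a (-Real.exp u) =
      -(Real.exp (-u) * (expSeries S a (u - Real.pi * Complex.I)).im) := by
  have hs := summable_expSeries hS ha hr (w := (u - Real.pi * Complex.I : ℂ)) (by simpa using hu)
  rw [tailDensity, expSeries, ← Complex.imCLM_apply, Complex.imCLM.map_tsum hs, ← neg_mul,
    ← tsum_mul_left]
  refine tsum_congr fun β => ?_
  rw [invPow, if_neg (by simpa using (Real.exp_pos u).le), abs_neg, abs_of_pos (Real.exp_pos u),
    ← Real.exp_mul, Complex.imCLM_apply, ← Complex.im_ofReal_mul]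
  congr 1
  push_cast
  have h1 : Complex.I * ((β : ℝ) + 1) * Real.pi =
      (β : ℝ) * Real.pi * Complex.I + Real.pi * Complex.I := by ring
  rw [h1, Complex.exp_add _ (Real.pi * Complex.I), Complex.exp_pi_mul_I]
  have h2 : Complex.exp (-(β : ℝ) * (u - Real.pi * Complex.I)) =
      Complex.exp (-(β : ℝ) * u) * Complex.exp ((β : ℝ) * Real.pi * Complex.I) := by
    rw [← Complex.exp_add]
    congr 1
    ring
  have h3 : Complex.exp (u * -((β : ℝ) + 1)) =
      Complex.exp (-u) * Complex.exp (-(β : ℝ) * u) := by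
    rw [← Complex.exp_add]
    congr 1
    ring
  rw [h2, h3]
  ring

/-- The density of the tail of a measure of class `P` is measurable on the tail. -/
lemma aemeasurable_tailDensity (hS : IsExponentSet S c)
    (ha : ∀ β : PosPart S, ‖a β‖ ≤ r ^ (β : ℝ)) (hr : 0 < r) (hR : 0 < R) (hcr : c * r < R) :
    AEMeasurable (tailDensity S a) (volume.restrict {x : ℝ | R ≤ |x|}) := by
  have hlog : ∀ x : ℝ, R ≤ x → Real.log (c * r) < Real.log x := fun x hx =>
    Real.log_lt_log (mul_pos hS.const_pos hr) (hcr.trans_le hx)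
  have hF := (differentiableOn_expSeries hS ha hr).continuousOn
  have hset : {x : ℝ | R ≤ |x|} = Ici R ∪ Iic (-R) := by
    ext x
    simp [le_abs, le_neg]
  have hlogc : ContinuousOn (fun x : ℝ => ((Real.log x : ℝ) : ℂ)) (Ici R) :=
    Complex.continuous_ofReal.comp_continuousOn
      (Real.continuousOn_log.mono fun x hx => (hR.trans_le hx).ne')
  rw [hset, aemeasurable_union_iff]
  constructor
  · refine ContinuousOn.aemeasurable ?_ measurableSet_Ici
    have h1 : ContinuousOn (fun x : ℝ => x⁻¹ * (expSeries S a (Real.log x : ℝ)).im) (Ici R) :=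
      (continuousOn_inv₀.mono fun x hx => (hR.trans_le hx).ne').mul
        (Complex.continuous_im.comp_continuousOn (hF.comp hlogc fun x hx => by
          simpa using hlog x hx))
    refine h1.congr fun x hx => ?_
    have h2 := tailDensity_exp hS ha hr (hlog x hx)
    rwa [Real.exp_neg, Real.exp_log (hR.trans_le hx)] at h2
  · refine ContinuousOn.aemeasurable ?_ measurableSet_Iic
    have h1 : ContinuousOn (fun x : ℝ => -(x⁻¹ *
        (expSeries S a ((Real.log x : ℝ) - Real.pi * Complex.I)).im)) (Ici R) :=
      ((continuousOn_inv₀.mono fun x hx => (hR.trans_le hx).ne').mul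
        (Complex.continuous_im.comp_continuousOn (hF.comp (hlogc.sub continuousOn_const)
          fun x hx => by simpa using hlog x hx))).neg
    refine (h1.comp continuous_neg.continuousOn fun x hx => ?_).congr fun x hx => ?_
    · simpa using le_neg.2 hx
    · have hx' : R ≤ -x := le_neg.2 hx
      have h2 := tailDensity_neg_exp hS ha hr (hlog (-x) hx')
      rwa [Real.exp_neg, Real.exp_log (hR.trans_le hx'), neg_neg] at h2

end Series

/-! ### Expansion of the Cauchy transform -/

lemma integrable_inv_sub {ν : Measure ℝ} [IsFiniteMeasure ν] {ζ : ℂ} (hζ : ζ.im < 0) :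
    Integrable (fun x : ℝ => 1 / (ζ - (x : ℂ))) ν := by
  have hne : ∀ x : ℝ, ζ - (x : ℂ) ≠ 0 := fun x h => by
    have := congrArg Complex.im h
    simp at this
    exact hζ.ne this
  refine (integrable_const (|ζ.im|⁻¹)).mono'
    (Continuous.aestronglyMeasurable (continuous_const.div (by fun_prop) hne))
    (ae_of_all _ fun x => ?_)
  rw [norm_div, norm_one, one_div]
  have h1 := Complex.abs_im_le_norm (ζ - (x : ℂ))
  simp only [Complex.sub_im, Complex.ofReal_im, sub_zero] at h1
  exact inv_anti₀ (abs_pos.2 hζ.ne) h1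

/-- The inclusion of `ℕ` into an exponent set. -/
def IsExponentSet.natIncl {S : AddSubsemigroup ℝ} {c : ℝ} (hS : IsExponentSet S c) (n : ℕ) : S :=
  ⟨n, hS.natCast_mem n⟩

lemma IsExponentSet.natIncl_injective {S : AddSubsemigroup ℝ} {c : ℝ} (hS : IsExponentSet S c) :
    Function.Injective hS.natIncl :=
  fun _ _ h => Nat.cast_injective (R := ℝ) (Subtype.mk.inj h)

lemma norm_extend_le {ι κ : Type*} {g : ι → κ} (hg : Function.Injective g) {f : ι → ℂ}
    {B : κ → ℝ} (hB : ∀ k, 0 ≤ B k) (hf : ∀ i, ‖f i‖ ≤ B (g i)) (k : κ) :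
    ‖Function.extend g f 0 k‖ ≤ B k := by
  by_cases h : ∃ i, g i = k
  · obtain ⟨i, rfl⟩ := h
    rw [hg.extend_apply]
    exact hf i
  · rw [Function.extend_apply' _ _ _ h]
    simpa using hB k

lemma hasSum_extend_div {ι κ : Type*} {g : ι → κ} (hg : Function.Injective g) {f : ι → ℂ}
    {p : κ → ℂ} {s : ℂ} (h : HasSum (fun i => f i / p (g i)) s) :
    HasSum (fun k => Function.extend g f 0 k / p k) s := by
  refine (hg.hasSum_iff fun k hk => ?_).1 (?_)
  · rw [Function.extend_apply' _ _ _ hk]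
    simp
  · convert h using 2 with i
    simp [hg.extend_apply]

section

variable {S : AddSubsemigroup ℝ} {c : ℝ}

/-- As `γ ≥ δ > 0`, the constant is absorbed into the base through `K ≤ (K^{1/δ})^γ`. The exponent
`0` has to be excluded. -/
lemma IsExponentSet.exists_geometric_bound (hS : IsExponentSet S c) {K M : ℝ} (hK : 1 ≤ K)
    (hM : 0 < M) : ∃ A : ℝ, 0 < A ∧ ∀ γ : S, 0 < (γ : ℝ) → K * M ^ (γ : ℝ) ≤ A ^ (γ : ℝ) := by
  obtain ⟨δ, hδ, hmin⟩ := hS.exists_pos_le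
  have hK0 : 0 < K := by linarith
  refine ⟨K ^ δ⁻¹ * M, by positivity, fun γ hγ => ?_⟩
  rw [Real.mul_rpow (by positivity) hM.le, ← Real.rpow_mul hK0.le]
  refine mul_le_mul_of_nonneg_right ?_ (by positivity)
  nth_rewrite 1 [← Real.rpow_one K]
  refine Real.rpow_le_rpow_of_exponent_le hK ?_
  rw [← div_eq_inv_mul, one_le_div hδ]
  exact hmin γ hγ

lemma hasSum_expSeries_div (hS : IsExponentSet S c) {r : ℝ} {a : PosPart S → ℂ}
    (ha : ∀ β : PosPart S, ‖a β‖ ≤ r ^ (β : ℝ)) (hr : 0 < r) {ζ : ℂ} (hζ0 : ζ ≠ 0)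
    (hζ : c * r < ‖ζ‖) :
    HasSum (fun β : PosPart S => a β / ζ ^ (((β : ℝ) : ℂ) + 1))
      (expSeries S a (Complex.log ζ) / ζ) := by
  have h1 := (summable_expSeries hS ha hr (w := Complex.log ζ) (by
    rw [Complex.log_re]
    exact Real.log_lt_log (mul_pos hS.const_pos hr) hζ)).hasSum.div_const ζ
  refine h1.congr_fun fun β => ?_
  rw [Complex.cpow_add _ _ hζ0, Complex.cpow_one, ← div_div, Complex.cpow_def_of_ne_zero hζ0,
    neg_mul, Complex.exp_neg, mul_comm (Complex.log ζ), div_eq_mul_inv (a β)]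

variable {μ : Measure ℝ} [IsProbabilityMeasure μ]

open ComplexConjugate in
/-- The Cauchy transform of a measure with power-law tails: the singular part comes from the tail
density, the rest is a Laurent series. -/
lemma exists_cauchyTransform_expansion (hS : IsExponentSet S c) (hμ : ClassP S c μ) :
    ∃ (a : PosPart S → ℂ) (κ : ℕ → ℂ) (r R C : ℝ), 0 < r ∧ 0 < R ∧ 0 ≤ C ∧
      (∀ β : PosPart S, ‖a β‖ ≤ r ^ (β : ℝ)) ∧ (∀ n, ‖κ n‖ ≤ C * R ^ n) ∧
      ∀ ζ : ℂ, ζ.im < 0 → R < ‖ζ‖ → ∃ s₁ s₂ : ℂ,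
        HasSum (fun β : PosPart S => (Real.pi * a β) / ζ ^ (((β : ℝ) : ℂ) + 1)) s₁ ∧
        HasSum (fun n : ℕ => κ n / ζ ^ (n + 1)) s₂ ∧ cauchyTransform μ ζ = s₁ + s₂ := by
  obtain ⟨a, r, R, hr, hR, hnn, hdens, ha, hrR⟩ := hμ
  have hcr : c * r < R := by
    have := mul_lt_mul_of_pos_left hrR hS.const_pos
    rwa [mul_inv_cancel_left₀ hS.const_pos.ne'] at this
  set ρ := Real.log R with hρ
  have hexpρ : Real.exp ρ = R := Real.exp_log hR
  have hρ₀ : Real.log (c * r) < ρ := Real.log_lt_log (mul_pos hS.const_pos hr) hcr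
  have hF := differentiableOn_expSeries hS ha hr
  obtain ⟨C, δ, hδ, hb⟩ := exists_norm_expSeries_le hS ha hr hρ₀
  set F := expSeries S a with hFdef
  have hline : ∀ y : ℝ, (ρ + y * Complex.I : ℂ) ∈ {w : ℂ | Real.log (c * r) < w.re} := fun y => by
    simpa using hρ₀
  have hline' : ∀ y : ℝ, conj (ρ + y * Complex.I : ℂ) ∈ {w : ℂ | Real.log (c * r) < w.re} :=
    fun y => by simpa using hρ₀
  have hc2 : Continuous fun y : ℝ => F (ρ + y * Complex.I) :=
    hF.continuousOn.comp_continuous (by fun_prop) hline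
  have hc3 : Continuous fun y : ℝ => conj (F (conj (ρ + y * Complex.I))) :=
    Complex.continuous_conj.comp (hF.continuousOn.comp_continuous (by fun_prop) hline')
  have hcont : Continuous fun y : ℝ => Complex.exp (ρ + y * Complex.I) := by fun_prop
  have hnorm : ∀ y : ℝ, ‖Complex.exp (ρ + y * Complex.I)‖ ≤ R := fun y => by
    rw [Complex.norm_exp]
    simp [hexpρ]
  set E : Set ℝ := {x : ℝ | R ≤ |x|} with hE
  have hEm : MeasurableSet E := measurableSet_le measurable_const (by fun_prop)
  -- Three Laurent series arise: the part of `μ` on `|x| < R`, and the lower and upper arcs `|e^w| =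
  -- R`.
  obtain ⟨b1, g1⟩ := hasSum_integral_geometric (ν := μ.restrict Eᶜ) (h := fun _ => 1)
    (k := fun x : ℝ => (x : ℂ)) (R := R) (integrable_const _) (by fun_prop)
    ((ae_restrict_mem hEm.compl).mono fun x hx => by
      have : |x| < R := not_le.1 hx
      simpa using this.le) hR.le
  obtain ⟨b2, g2⟩ := hasSum_integral_geometric (ν := volume.restrict (Ioc (-Real.pi) 0))
    (h := fun y : ℝ => F (ρ + y * Complex.I)) (k := fun y : ℝ => Complex.exp (ρ + y * Complex.I))
    (R := R) (hc2.integrableOn_Ioc) hcont.aestronglyMeasurable (ae_of_all _ hnorm) hR.le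
  obtain ⟨b3, g3⟩ := hasSum_integral_geometric (ν := volume.restrict (Ioc 0 Real.pi))
    (h := fun y : ℝ => conj (F (conj (ρ + y * Complex.I))))
    (k := fun y : ℝ => Complex.exp (ρ + y * Complex.I))
    (R := R) (hc3.integrableOn_Ioc) hcont.aestronglyMeasurable (ae_of_all _ hnorm) hR.le
  set I₁ : ℕ → ℂ := fun n => ∫ x in Eᶜ, 1 * (x : ℂ) ^ n ∂μ with hI₁
  set I₂ : ℕ → ℂ := fun n => ∫ y in Ioc (-Real.pi) 0,
    F (ρ + y * Complex.I) * Complex.exp (ρ + y * Complex.I) ^ n with hI₂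
  set I₃ : ℕ → ℂ := fun n => ∫ y in Ioc 0 Real.pi,
    conj (F (conj (ρ + y * Complex.I))) * Complex.exp (ρ + y * Complex.I) ^ n with hI₃
  set C₁ := ∫ _ in Eᶜ, ‖(1 : ℂ)‖ ∂μ
  set C₂ := ∫ y in Ioc (-Real.pi) 0, ‖F (ρ + y * Complex.I)‖
  set C₃ := ∫ y in Ioc 0 Real.pi, ‖conj (F (conj (ρ + y * Complex.I)))‖
  have hC₁ : 0 ≤ C₁ := integral_nonneg fun _ => norm_nonneg _
  have hC₂ : 0 ≤ C₂ := integral_nonneg fun _ => norm_nonneg _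
  have hC₃ : 0 ≤ C₃ := integral_nonneg fun _ => norm_nonneg _
  refine ⟨a, fun n => I₁ n - I₂ n / 2 - I₃ n / 2, r, R, C₁ + C₂ / 2 + C₃ / 2, hr, hR,
    by positivity, ha, fun n => ?_, fun ζ hζ hRζ => ?_⟩
  · have e1 : ‖I₁ n‖ ≤ C₁ * R ^ n := b1 n
    have e2 : ‖I₂ n‖ ≤ C₂ * R ^ n := b2 n
    have e3 : ‖I₃ n‖ ≤ C₃ * R ^ n := b3 n
    have e4 := norm_sub_le (I₁ n - I₂ n / 2) (I₃ n / 2)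
    have e5 := norm_sub_le (I₁ n) (I₂ n / 2)
    rw [norm_div, Complex.norm_ofNat] at e4 e5
    linarith
  · have hζ0 : ζ ≠ 0 := norm_pos_iff.1 (hR.trans hRζ)
    refine ⟨Real.pi * (F (Complex.log ζ) / ζ), _, ?_,
      (((g1 ζ hRζ).sub ((g2 ζ hRζ).div_const 2)).sub ((g3 ζ hRζ).div_const 2)).congr_fun
        fun n => ?_, ?_⟩
    · refine ((hasSum_expSeries_div hS ha hr hζ0 (hcr.trans hRζ)).mul_left (Real.pi : ℂ)).congr_fun
        fun β => ?_
      rw [mul_div_assoc]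
    · ring
    · have htail := integral_tail hF hρ₀ hδ hb hζ (hexpρ.trans_lt hRζ) (D := tailDensity S a)
        (fun u hu => tailDensity_exp hS ha hr (hρ₀.trans hu))
        (fun u hu => tailDensity_neg_exp hS ha hr (hρ₀.trans hu))
      rw [hexpρ, intervalIntegral.integral_of_le (by linarith [Real.pi_pos]),
        intervalIntegral.integral_of_le Real.pi_pos.le] at htail
      have hmeas : ∫ x in E, 1 / (ζ - (x : ℂ)) ∂μ =
          ∫ x in E, (tailDensity S a x : ℂ) / (ζ - (x : ℂ)) := by
        rw [hdens, integral_withDensity_eq_integral_toReal_smul₀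
          (aemeasurable_tailDensity hS ha hr hR hcr).ennreal_ofReal
          (ae_of_all _ fun x => ENNReal.ofReal_lt_top)]
        refine integral_congr_ae ?_
        -- Nonnegativity of the density undoes the truncation in `ENNReal.ofReal`.
        filter_upwards [ae_restrict_mem hEm, ae_restrict_of_ae hnn] with x hx hx'
        rw [ENNReal.toReal_ofReal (hx' hx), Complex.real_smul, mul_one_div]
      rw [cauchyTransform, ← integral_add_compl hEm (integrable_inv_sub hζ), hmeas, htail]
      ring

/-- The Cauchy transform of a measure of class `P` has an expansion over `S` whose coefficients
are geometrically bounded. -/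
lemma exists_hasCauchyExpansion (hS : IsExponentSet S c) (hμ : ClassP S c μ) :
    ∃ (m : S → ℂ) (A : ℝ), 0 < A ∧ (∀ γ : S, 0 < (γ : ℝ) → ‖m γ‖ ≤ A ^ (γ : ℝ)) ∧
      HasCauchyExpansion S μ m := by
  obtain ⟨a, κ, r, R, C, hr, hR, hC, ha, hκ, hG⟩ := exists_cauchyTransform_expansion hS hμ
  obtain ⟨A, hA, hbound⟩ := hS.exists_geometric_bound (K := Real.pi + C + 1) (M := max r R)
    (by linarith [Real.pi_pos]) (hr.trans_le (le_max_left _ _))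
  -- Extension by zero puts both series on `S`; a positive integer exponent receives both
  -- contributions.
  set m₁ : S → ℂ := Function.extend (PosPart.incl S) (fun β => Real.pi * a β) 0
  set m₂ : S → ℂ := Function.extend hS.natIncl κ 0
  refine ⟨fun γ => m₁ γ + m₂ γ, A, hA, fun γ hγ => ?_, R, fun ζ hζ hRζ => ?_⟩
  · have h1 : ‖m₁ γ‖ ≤ Real.pi * r ^ (γ : ℝ) :=
      norm_extend_le (PosPart.incl_injective S) (B := fun γ : S => Real.pi * r ^ (γ : ℝ))
        (fun γ => by positivity) (fun β => by
          rw [norm_mul, Complex.norm_real, Real.norm_of_nonneg Real.pi_pos.le]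
          exact mul_le_mul_of_nonneg_left (ha β) Real.pi_pos.le) γ
    have h2 : ‖m₂ γ‖ ≤ C * R ^ (γ : ℝ) :=
      norm_extend_le hS.natIncl_injective (B := fun γ : S => C * R ^ (γ : ℝ))
        (fun γ => by positivity) (fun n => by
          simpa [IsExponentSet.natIncl] using hκ n) γ
    have h3 : r ^ (γ : ℝ) ≤ (max r R) ^ (γ : ℝ) :=
      Real.rpow_le_rpow hr.le (le_max_left _ _) hγ.le
    have h4 : R ^ (γ : ℝ) ≤ (max r R) ^ (γ : ℝ) :=
      Real.rpow_le_rpow hR.le (le_max_right _ _) hγ.le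
    have h5 : 0 ≤ (max r R) ^ (γ : ℝ) := (Real.rpow_nonneg hR.le _).trans h4
    refine le_trans ?_ (hbound γ hγ)
    calc ‖m₁ γ + m₂ γ‖ ≤ Real.pi * r ^ (γ : ℝ) + C * R ^ (γ : ℝ) :=
          (norm_add_le _ _).trans (add_le_add h1 h2)
      _ ≤ Real.pi * (max r R) ^ (γ : ℝ) + C * (max r R) ^ (γ : ℝ) := by gcongr
      _ ≤ (Real.pi + C + 1) * (max r R) ^ (γ : ℝ) := by linarith
  · obtain ⟨s₁, s₂, h1, h2, h3⟩ := hG ζ hζ hRζ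
    rw [h3]
    simp only [add_div]
    refine HasSum.add ?_ ?_
    · exact hasSum_extend_div (PosPart.incl_injective S)
        (p := fun γ : S => ζ ^ (((γ : ℝ) : ℂ) + 1)) h1
    · refine hasSum_extend_div hS.natIncl_injective
        (p := fun γ : S => ζ ^ (((γ : ℝ) : ℂ) + 1)) (h2.congr_fun fun n => ?_)
      have : (((hS.natIncl n : S) : ℝ) : ℂ) + 1 = ((n + 1 : ℕ) : ℂ) := by
        simp [IsExponentSet.natIncl]
      rw [this, Complex.cpow_natCast]

end

/-! ### Laplace transforms -/

lemma integrableOn_rpow_mul_exp {γ : ℝ} (hγ : 0 ≤ γ) {σ : ℝ} (hσ : 0 < σ) :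
    IntegrableOn (fun t : ℝ => t ^ γ * Real.exp (-σ * t)) (Ioi 0) := by
  have := integrableOn_rpow_mul_exp_neg_mul_rpow (p := 1) (s := γ) (b := σ) (by linarith) one_pos hσ
  simpa using this

/-- Restrict the Gamma integral to `t > x` and use `t^γ ≥ x^γ` there. -/
lemma rpow_div_Gamma_le_exp {γ x : ℝ} (hγ : 0 ≤ γ) (hx : 0 < x) :
    x ^ γ / Real.Gamma (γ + 1) ≤ Real.exp x := by
  have hpos : 0 < Real.Gamma (γ + 1) := Real.Gamma_pos_of_pos (by linarith)
  have hint : IntegrableOn (fun t : ℝ => Real.exp (-t) * t ^ (γ + 1 - 1)) (Ioi 0) :=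
    Real.GammaIntegral_convergent (by linarith)
  have h1 : x ^ γ * Real.exp (-x) ≤ Real.Gamma (γ + 1) := by
    rw [Real.Gamma_eq_integral (by linarith), ← integral_exp_neg_Ioi x, ← integral_const_mul]
    refine le_trans ?_ (setIntegral_mono_set hint ?_ (Ioi_subset_Ioi hx.le).eventuallyLE)
    · refine setIntegral_mono_on ?_ (hint.mono_set (Ioi_subset_Ioi hx.le)) measurableSet_Ioi
        fun t ht => ?_
      · exact (by simpa using exp_neg_integrableOn_Ioi x one_pos :
          IntegrableOn (fun t : ℝ => Real.exp (-t)) (Ioi x)).const_mul _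
      · rw [mul_comm, add_sub_cancel_right]
        have : x ^ γ ≤ t ^ γ := Real.rpow_le_rpow hx.le (le_of_lt ht) hγ
        gcongr
    · filter_upwards [ae_restrict_mem measurableSet_Ioi] with t ht
      exact mul_nonneg (Real.exp_pos _).le (Real.rpow_nonneg (le_of_lt ht) _)
  rw [div_le_iff₀ hpos]
  rw [Real.exp_neg, ← div_eq_mul_inv, div_le_iff₀ (Real.exp_pos x)] at h1
  linarith

lemma differentiableOn_laplace_rpow {γ : ℝ} (hγ : 0 ≤ γ) :
    DifferentiableOn ℂ (fun s : ℂ => ∫ t : ℝ in Ioi 0, ((t ^ γ : ℝ) : ℂ) * Complex.exp (-s * t))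
      {s | 0 < s.re} := by
  intro s hs
  have hs' : 0 < s.re := hs
  have hmeas : ∀ z : ℂ, AEStronglyMeasurable
      (fun t : ℝ => ((t ^ γ : ℝ) : ℂ) * Complex.exp (-z * t)) (volume.restrict (Ioi 0)) :=
    fun z => by
      have h1 : Measurable fun t : ℝ => ((t ^ γ : ℝ) : ℂ) := by fun_prop
      exact (h1.mul (by fun_prop)).aestronglyMeasurable
  have hopen : {z : ℂ | s.re / 2 < z.re} ∈ 𝓝 s :=
    (isOpen_lt continuous_const Complex.continuous_re).mem_nhds (by simp; linarith)
  have hb := integrableOn_rpow_mul_exp (γ := γ + 1) (by linarith) (half_pos hs')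
  have := hasDerivAt_integral_of_dominated_loc_of_deriv_le (μ := volume.restrict (Ioi (0 : ℝ)))
    (F := fun (z : ℂ) (t : ℝ) => ((t ^ γ : ℝ) : ℂ) * Complex.exp (-z * t))
    (F' := fun (z : ℂ) (t : ℝ) => ((t ^ γ : ℝ) : ℂ) * (Complex.exp (-z * t) * (-t)))
    (x₀ := s) hopen (Eventually.of_forall hmeas) ?_ ?_ ?_ hb ?_
  · exact this.2.differentiableAt.differentiableWithinAt
  · refine (integrableOn_rpow_mul_exp hγ hs').mono' (hmeas s) ?_
    filter_upwards [ae_restrict_mem measurableSet_Ioi] with t ht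
    rw [norm_mul, Complex.norm_real, Real.norm_of_nonneg (Real.rpow_nonneg (le_of_lt ht) _),
      Complex.norm_exp]
    simp
  · have h1 : Measurable fun t : ℝ => ((t ^ γ : ℝ) : ℂ) := by fun_prop
    exact (h1.mul (by fun_prop)).aestronglyMeasurable
  · filter_upwards [ae_restrict_mem measurableSet_Ioi] with t ht z hz
    have ht' : 0 < t := ht
    rw [norm_mul, norm_mul, Complex.norm_real, Real.norm_of_nonneg (Real.rpow_nonneg ht'.le _),
      Complex.norm_exp, norm_neg, Complex.norm_real, Real.norm_of_nonneg ht'.le,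
      Real.rpow_add ht', Real.rpow_one, mul_assoc, mul_comm (Real.exp _) t]
    have h2 : (-z * t : ℂ).re ≤ -(s.re / 2) * t := by
      have h3 : s.re / 2 < z.re := hz
      simp
      nlinarith
    gcongr
  · refine ae_of_all _ fun t z _ => ?_
    have h1 : HasDerivAt (fun z : ℂ => -z * t) (-(t : ℂ)) z := by
      simpa using (hasDerivAt_id z).neg.mul_const (t : ℂ)
    exact h1.cexp.const_mul _

/-- The Laplace transform of `t ^ γ` on the right half plane. -/
lemma integral_rpow_mul_cexp {γ : ℝ} (hγ : 0 ≤ γ) {s : ℂ} (hs : 0 < s.re) :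
    ∫ t : ℝ in Ioi 0, ((t ^ γ : ℝ) : ℂ) * Complex.exp (-s * t) =
      Real.Gamma (γ + 1) * s ^ (-((γ : ℂ) + 1)) := by
  have hopen : IsOpen {s : ℂ | 0 < s.re} := isOpen_lt continuous_const Complex.continuous_re
  have h1 := (differentiableOn_laplace_rpow hγ).analyticOnNhd hopen
  have h2 : AnalyticOnNhd ℂ (fun s : ℂ => (Real.Gamma (γ + 1) : ℂ) * s ^ (-((γ : ℂ) + 1)))
      {s | 0 < s.re} := by
    refine DifferentiableOn.analyticOnNhd (fun s hs => ?_) hopen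
    refine DifferentiableAt.differentiableWithinAt ?_
    exact (differentiableAt_id.cpow_const (Or.inl hs)).const_mul _
  have hconn : IsPreconnected {s : ℂ | 0 < s.re} :=
    (convex_halfSpace_re_gt 0).isPreconnected
  have hreal : ∀ x : ℝ, 0 < x → (∫ t : ℝ in Ioi 0, ((t ^ γ : ℝ) : ℂ) * Complex.exp (-(x : ℂ) * t)) =
      Real.Gamma (γ + 1) * (x : ℂ) ^ (-((γ : ℂ) + 1)) := by
    intro x hx
    have h3 := Complex.integral_cpow_mul_exp_neg_mul_Ioi (a := (γ : ℂ) + 1) (r := x)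
      (by simp; linarith) hx
    rw [Complex.cpow_neg, ← Complex.inv_cpow _ _ (by
      rw [Complex.arg_ofReal_of_nonneg hx.le]; exact Real.pi_pos.ne), ← one_div, mul_comm,
      ← Complex.Gamma_ofReal, Complex.ofReal_add, Complex.ofReal_one, ← h3]
    refine setIntegral_congr_fun measurableSet_Ioi fun t ht => ?_
    simp only [add_sub_cancel_right]
    rw [Complex.ofReal_cpow (le_of_lt ht), neg_mul]
  -- Both sides are analytic on the right half plane and agree for real `s`; the points `1 +
  -- 1/(n+1)` accumulate at `1`, so the identity theorem applies.
  refine h1.eqOn_of_preconnected_of_frequently_eq h2 hconn (z₀ := 1) (by simp) ?_ hs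
  have htend : Tendsto (fun n : ℕ => ((1 + 1 / ((n : ℝ) + 1) : ℝ) : ℂ)) atTop (𝓝[≠] 1) := by
    refine tendsto_nhdsWithin_iff.2 ⟨?_, Eventually.of_forall fun n => ?_⟩
    · have := (tendsto_one_div_add_atTop_nhds_zero_nat (𝕜 := ℝ)).const_add 1
      rw [add_zero] at this
      rw [← Complex.ofReal_one]
      exact (Complex.continuous_ofReal.tendsto 1).comp this
    · have : (0 : ℝ) < 1 / ((n : ℝ) + 1) := by positivity
      simp only [mem_compl_iff, mem_singleton_iff, ← Complex.ofReal_one, Complex.ofReal_inj]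
      linarith
  exact htend.frequently (Frequently.of_forall fun n => hreal _ (by positivity))

/-- Uniqueness of Laplace transforms along a vertical line. -/
lemma eq_zero_of_integral_exp_eq_zero {g : ℝ → ℂ} (hg : IntegrableOn g (Ioi 0))
    (hc : ContinuousOn g (Ioi 0))
    (h0 : ∀ y : ℝ, ∫ t : ℝ in Ioi 0, g t * Complex.exp (-(y * Complex.I) * t) = 0) :
    ∀ t : ℝ, 0 < t → g t = 0 := by
  intro t ht
  set f := (Ioi (0 : ℝ)).indicator g with hf
  have hfi : Integrable f := (integrable_indicator_iff measurableSet_Ioi).2 hg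
  -- Extended by zero to the whole line, `g` has vanishing Fourier transform; inversion recovers it
  -- at points of continuity.
  have hF : FourierTransform.fourier f = (0 : ℝ → ℂ) := by
    funext w
    rw [Real.fourier_real_eq_integral_exp_smul, Pi.zero_apply, ← h0 (2 * Real.pi * w),
      ← integral_indicator measurableSet_Ioi]
    refine integral_congr_ae (ae_of_all _ fun v => ?_)
    simp only [hf, indicator_apply]
    split_ifs
    · rw [smul_eq_mul, mul_comm]
      congr 2
      push_cast
      ring
    · simp
  have hft : f =ᶠ[𝓝 t] g := by
    filter_upwards [Ioi_mem_nhds ht] with v hv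
    exact indicator_of_mem hv g
  have hct : ContinuousAt f t := (hc.continuousAt (Ioi_mem_nhds ht)).congr hft.symm
  have := hfi.fourierInv_fourier_eq (by rw [hF]; exact integrable_zero _ _ _) hct
  rw [← hft.eq_of_nhds, ← this, hF]
  simp [Real.fourierInv_eq']

/-- The Laplace transform of a characteristic function is a Cauchy transform. -/
lemma laplace_charFun {μ : Measure ℝ} [IsProbabilityMeasure μ] {s : ℂ} (hs : 0 < s.re) :
    ∫ t : ℝ in Ioi 0, charFun μ t * Complex.exp (-s * t) =
      -Complex.I * cauchyTransform μ (-Complex.I * s) := by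
  have h1 : ∀ t : ℝ, charFun μ t * Complex.exp (-s * t) =
      ∫ x : ℝ, Complex.exp ((x * Complex.I - s) * t) ∂μ := fun t => by
    rw [charFun_apply_real, ← integral_mul_const]
    refine integral_congr_ae (ae_of_all _ fun x => ?_)
    simp only
    rw [← Complex.exp_add]
    congr 1
    ring
  have hre : ∀ x : ℝ, (x * Complex.I - s).re = -s.re := fun x => by simp
  have hint : Integrable (Function.uncurry fun (t x : ℝ) =>
      Complex.exp ((x * Complex.I - s) * t)) ((volume.restrict (Ioi 0)).prod μ) := by
    have h2 : Integrable (fun z : ℝ × ℝ => Real.exp (-s.re * z.1) * (1 : ℝ))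
        ((volume.restrict (Ioi 0)).prod μ) :=
      Integrable.mul_prod (f := fun t : ℝ => Real.exp (-s.re * t)) (g := fun _ : ℝ => (1 : ℝ))
        (exp_neg_integrableOn_Ioi 0 hs) (integrable_const 1)
    refine h2.mono' (Continuous.aestronglyMeasurable (by
      unfold Function.uncurry; fun_prop)) (ae_of_all _ fun z => ?_)
    rw [Function.uncurry, Complex.norm_exp]
    simp
  simp_rw [h1]
  rw [integral_integral_swap hint, cauchyTransform, ← integral_const_mul]
  refine integral_congr_ae (ae_of_all _ fun x => ?_)
  simp only
  rw [integral_exp_mul_complex_Ioi (by rw [hre]; linarith)]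
  have hne : x * Complex.I - s ≠ 0 := fun h => by
    have := hre x
    rw [h] at this
    simp at this
    linarith
  have h3 : -Complex.I * s - x = Complex.I * (x * Complex.I - s) := by
    linear_combination (-x : ℂ) * Complex.I_sq
  rw [h3]
  have hI := Complex.I_ne_zero
  simp only [Complex.ofReal_zero, mul_zero, Complex.exp_zero]
  field_simp

/-! ### Termwise Laplace transform of the Fourier series -/

/-- The term of index `γ` of the Fourier expansion with coefficients `m`. -/
noncomputable def fourierTerm {S : AddSubsemigroup ℝ} (m : S → ℂ) (γ : S) (t : ℝ) : ℂ :=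
  m γ / (Real.Gamma ((γ : ℝ) + 1) : ℂ) * Complex.I ^ ((γ : ℝ) : ℂ) * ((t ^ (γ : ℝ) : ℝ) : ℂ)

lemma norm_I_cpow (x : ℝ) : ‖Complex.I ^ (x : ℂ)‖ = 1 := by
  rw [Complex.cpow_def_of_ne_zero Complex.I_ne_zero, Complex.log_I, Complex.norm_exp]
  simp

section

variable {S : AddSubsemigroup ℝ} {c A B σ : ℝ} {m : S → ℂ}

/-- Applying `rpow_div_Gamma_le_exp` at `x = σ t` trades growth in `t` for a geometric factor. The
free parameter `σ > c A` makes the bounds summable over `S`. -/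
lemma norm_fourierTerm_le (hS : IsExponentSet S c) (hA : 0 < A)
    (hm : ∀ γ : S, ‖m γ‖ ≤ B * A ^ (γ : ℝ)) (hσ : 0 < σ) (γ : S) {t : ℝ} (ht : 0 < t) :
    ‖fourierTerm m γ t‖ ≤ B * (A / σ) ^ (γ : ℝ) * Real.exp (σ * t) := by
  have hγ := hS.nonneg _ γ.2
  have hpos : 0 < Real.Gamma ((γ : ℝ) + 1) := Real.Gamma_pos_of_pos (by linarith)
  have hB : 0 ≤ B * A ^ (γ : ℝ) := (norm_nonneg _).trans (hm γ)
  have hA' : 0 < A ^ (γ : ℝ) := Real.rpow_pos_of_pos hA _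
  have hB' : 0 ≤ B := nonneg_of_mul_nonneg_left hB hA'
  rw [fourierTerm, norm_mul, norm_mul, norm_I_cpow, norm_div, Complex.norm_real, Complex.norm_real,
    Real.norm_of_nonneg hpos.le, Real.norm_of_nonneg (Real.rpow_nonneg ht.le _), mul_one]
  have h1 := rpow_div_Gamma_le_exp hγ (mul_pos hσ ht)
  have hσγ : 0 < σ ^ (γ : ℝ) := Real.rpow_pos_of_pos hσ _
  calc ‖m γ‖ / Real.Gamma ((γ : ℝ) + 1) * t ^ (γ : ℝ)
      ≤ B * A ^ (γ : ℝ) / Real.Gamma ((γ : ℝ) + 1) * t ^ (γ : ℝ) := by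
        gcongr
        exact hm γ
    _ = B * (A / σ) ^ (γ : ℝ) * ((σ * t) ^ (γ : ℝ) / Real.Gamma ((γ : ℝ) + 1)) := by
        rw [Real.div_rpow hA.le hσ.le, Real.mul_rpow hσ.le ht.le]
        field_simp
    _ ≤ _ := by gcongr

lemma summable_geometric_bound (hS : IsExponentSet S c) (hA : 0 < A) (hσ : c * A < σ) :
    Summable fun γ : S => B * (A / σ) ^ (γ : ℝ) := by
  have hσ0 : 0 < σ := (mul_pos hS.const_pos hA).trans hσ
  refine (hS.summable_rpow (div_pos hA hσ0) ?_).mul_left B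
  rw [← mul_div_assoc]
  exact (div_lt_one hσ0).2 hσ

lemma summable_fourierTerm (hS : IsExponentSet S c) (hA : 0 < A)
    (hm : ∀ γ : S, ‖m γ‖ ≤ B * A ^ (γ : ℝ)) {t : ℝ} (ht : 0 < t) :
    Summable fun γ : S => fourierTerm m γ t := by
  have hσ0 : 0 < c * A + 1 := by linarith [mul_pos hS.const_pos hA]
  exact Summable.of_norm_bounded
    ((summable_geometric_bound hS hA (lt_add_one (c * A))).mul_right _)
    fun γ => norm_fourierTerm_le hS hA hm hσ0 γ ht

lemma continuousOn_tsum_fourierTerm (hS : IsExponentSet S c) (hA : 0 < A)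
    (hm : ∀ γ : S, ‖m γ‖ ≤ B * A ^ (γ : ℝ)) :
    ContinuousOn (fun t => ∑' γ : S, fourierTerm m γ t) (Ioi 0) := by
  intro t ht
  have hσ0 : 0 < c * A + 1 := by linarith [mul_pos hS.const_pos hA]
  have hmem : Ioo 0 (t + 1) ∈ 𝓝 t := Ioo_mem_nhds ht (lt_add_one t)
  have := continuousOn_tsum (s := Ioo 0 (t + 1)) (f := fun (γ : S) t => fourierTerm m γ t)
    (u := fun γ : S => B * (A / (c * A + 1)) ^ (γ : ℝ) * Real.exp ((c * A + 1) * (t + 1)))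
    (fun γ => ?_) ((summable_geometric_bound hS hA (lt_add_one (c * A))).mul_right _)
    fun γ x hx => (norm_fourierTerm_le hS hA hm hσ0 γ hx.1).trans ?_
  · exact (this.continuousAt hmem).continuousWithinAt
  · refine continuousOn_const.mul (Complex.continuous_ofReal.comp_continuousOn ?_)
    exact continuousOn_id.rpow_const fun x hx => Or.inl (ne_of_gt hx.1)
  · have h1 : 0 ≤ B * (A / (c * A + 1)) ^ (γ : ℝ) := by
      have := (norm_nonneg _).trans (norm_fourierTerm_le hS hA hm hσ0 γ hx.1)
      exact nonneg_of_mul_nonneg_left this (Real.exp_pos _)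
    have h2 := hx.2.le
    gcongr

lemma measurable_fourierTerm (γ : S) : Measurable (fourierTerm m γ) := by
  unfold fourierTerm
  fun_prop

/-- The Laplace transform of a Fourier expansion, computed term by term. -/
lemma hasSum_laplace_fourierTerm (hS : IsExponentSet S c) (hA : 0 < A)
    (hm : ∀ γ : S, ‖m γ‖ ≤ B * A ^ (γ : ℝ)) {s : ℂ} (hs : c * A < s.re) :
    IntegrableOn (fun t : ℝ => (∑' γ : S, fourierTerm m γ t) * Complex.exp (-s * t)) (Ioi 0) ∧
    HasSum (fun γ : S => -Complex.I * (m γ / (-Complex.I * s) ^ (((γ : ℝ) : ℂ) + 1)))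
      (∫ t : ℝ in Ioi 0, (∑' γ : S, fourierTerm m γ t) * Complex.exp (-s * t)) := by
  -- `σ > c A` gives summability in `γ`, and `σ < Re s` gives integrability in `t`.
  obtain ⟨σ, hσ1, hσ2⟩ := exists_between hs
  have hσ0 : 0 < σ := (mul_pos hS.const_pos hA).trans hσ1
  have hs0 : 0 < s.re := hσ0.trans hσ2
  have hdiff : 0 < s.re - σ := sub_pos.2 hσ2
  have hsum := summable_geometric_bound (B := B) hS hA hσ1
  have hcount : Countable S := by
    have : (⋃ n : ℕ, {γ : S | (γ : ℝ) ≤ n}) = univ := by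
      ext γ
      simpa using exists_nat_ge (γ : ℝ)
    exact countable_univ_iff.1 (this ▸ countable_iUnion fun n : ℕ =>
      (hS.finite_le n).countable)
  have hle : ∀ γ : S, ∀ t ∈ Ioi (0 : ℝ), ‖fourierTerm m γ t * Complex.exp (-s * t)‖ ≤
      B * (A / σ) ^ (γ : ℝ) * Real.exp (-(s.re - σ) * t) := fun γ t ht => by
    rw [norm_mul, Complex.norm_exp]
    refine (mul_le_mul_of_nonneg_right (norm_fourierTerm_le hS hA hm hσ0 γ ht)
      (Real.exp_pos _).le).trans_eq ?_
    rw [mul_assoc, ← Real.exp_add]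
    congr 2
    simp
    ring
  have hexp := exp_neg_integrableOn_Ioi 0 hdiff
  have hint : ∀ γ : S, IntegrableOn (fun t : ℝ => fourierTerm m γ t * Complex.exp (-s * t))
      (Ioi 0) := fun γ =>
    (hexp.const_mul (B * (A / σ) ^ (γ : ℝ))).mono'
      ((measurable_fourierTerm γ).mul (by fun_prop)).aestronglyMeasurable
      ((ae_restrict_mem measurableSet_Ioi).mono (hle γ))
  have hnorm : Summable fun γ : S =>
      ∫ t : ℝ in Ioi 0, ‖fourierTerm m γ t * Complex.exp (-s * t)‖ := by
    refine (hsum.mul_right (∫ t : ℝ in Ioi 0, Real.exp (-(s.re - σ) * t))).of_nonneg_of_le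
      (fun γ => integral_nonneg fun _ => norm_nonneg _) fun γ => ?_
    rw [← integral_const_mul]
    exact setIntegral_mono_on (hint γ).norm (hexp.const_mul _) measurableSet_Ioi (hle γ)
  have key := hasSum_integral_of_summable_integral_norm
    (F := fun (γ : S) (t : ℝ) => fourierTerm m γ t * Complex.exp (-s * t)) hint hnorm
  simp only [tsum_mul_right] at key
  refine ⟨?_, key.congr_fun fun γ => ?_⟩
  · refine (hexp.const_mul (∑' γ : S, B * (A / σ) ^ (γ : ℝ))).mono' ?_ ?_
    · exact ((continuousOn_tsum_fourierTerm hS hA hm).mul (by fun_prop)).aestronglyMeasurable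
        measurableSet_Ioi
    · filter_upwards [ae_restrict_mem measurableSet_Ioi] with t ht
      rw [← tsum_mul_right, ← tsum_mul_right]
      exact tsum_of_norm_bounded (hsum.mul_right _).hasSum fun γ => hle γ t ht
  · have hγ := hS.nonneg _ γ.2
    have hΓ : (Real.Gamma ((γ : ℝ) + 1) : ℂ) ≠ 0 := by
      exact_mod_cast (Real.Gamma_pos_of_pos (by linarith)).ne'
    have hne : s ≠ 0 := by rintro rfl; simp at hs0
    simp only [fourierTerm, mul_assoc]
    rw [integral_const_mul, integral_const_mul, integral_rpow_mul_cexp hγ hs0,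
      Complex.cpow_def_of_ne_zero Complex.I_ne_zero, Complex.cpow_def_of_ne_zero hne,
      Complex.cpow_def_of_ne_zero (mul_ne_zero (neg_ne_zero.2 Complex.I_ne_zero) hne),
      log_neg_I_mul hs0, Complex.log_I, div_eq_mul_inv (m γ) (Complex.exp _), ← Complex.exp_neg]
    -- Since `log (-is) = log s - iπ/2`, this is `(-is)^{-γ-1} = i · i^γ s^{-γ-1}`.
    have h1 : Complex.exp (-((Complex.log s - Real.pi / 2 * Complex.I) * (((γ : ℝ) : ℂ) + 1))) =
        Complex.exp (Real.pi / 2 * Complex.I * (γ : ℝ)) *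
          Complex.exp (Complex.log s * -(((γ : ℝ) : ℂ) + 1)) *
          Complex.exp (Real.pi / 2 * Complex.I) := by
      rw [← Complex.exp_add, ← Complex.exp_add]
      congr 1
      ring
    rw [h1, Complex.exp_pi_div_two_mul_I, div_mul_eq_mul_div (m γ), eq_div_iff hΓ]
    linear_combination (-(m γ * Complex.exp (Real.pi / 2 * Complex.I * (γ : ℝ)) *
      Complex.exp (Complex.log s * -(((γ : ℝ) : ℂ) + 1)) * Real.Gamma ((γ : ℝ) + 1))) *
        Complex.I_sq

/-! ### Uniqueness, and passage from the Cauchy to the Fourier expansion -/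

variable {μ : Measure ℝ}

lemma HasFourierExpansion.unique (hS : IsExponentSet S c) {m' : S → ℂ}
    (h : HasFourierExpansion S μ m) (h' : HasFourierExpansion S μ m') : m = m' := by
  have h0 := hS.eq_zero_of_hasSum_zero (t₁ := 1) (b := fun γ : S =>
    (m γ - m' γ) / (Real.Gamma ((γ : ℝ) + 1) : ℂ) * Complex.I ^ ((γ : ℝ) : ℂ)) one_pos
    fun t ht _ => by
      have := (h t ht).sub (h' t ht)
      rw [sub_self] at this
      refine this.congr_fun fun γ => ?_
      ring
  funext γ
  have h1 := congrFun h0 γ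
  have hΓ : (Real.Gamma ((γ : ℝ) + 1) : ℂ) ≠ 0 := by
    exact_mod_cast (Real.Gamma_pos_of_pos (by linarith [hS.nonneg _ γ.2])).ne'
  have hI : Complex.I ^ ((γ : ℝ) : ℂ) ≠ 0 := by
    rw [← norm_ne_zero_iff, norm_I_cpow]
    exact one_ne_zero
  simpa [hΓ, hI, sub_eq_zero] using h1

/-- On the ray `z = -i/t` the expansion, multiplied by `1/t`, is a generalised power series in `t`,
whose coefficients are determined near `0+`. -/
lemma HasCauchyExpansion.unique (hS : IsExponentSet S c) {m' : S → ℂ}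
    (h : HasCauchyExpansion S μ m) (h' : HasCauchyExpansion S μ m') : m = m' := by
  obtain ⟨M, hM⟩ := h
  obtain ⟨M', hM'⟩ := h'
  set N := max (max M M') 0 + 1 with hN
  have hN0 : 0 < N := (le_max_right _ _).trans_lt (lt_add_one _)
  have hNM : M < N :=
    ((le_max_left _ _).trans (le_max_left _ _)).trans_lt (lt_add_one _)
  have hNM' : M' < N :=
    ((le_max_right _ _).trans (le_max_left _ _)).trans_lt (lt_add_one _)
  have h0 := hS.eq_zero_of_hasSum_zero (t₁ := N⁻¹) (b := fun γ : S =>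
    (m γ - m' γ) / (-Complex.I) ^ (((γ : ℝ) : ℂ) + 1)) (inv_pos.2 hN0) fun t ht htN => by
      have hNt : N < t⁻¹ := by rwa [lt_inv_comm₀ hN0 ht]
      have him : (((t⁻¹ : ℝ) : ℂ) * -Complex.I).im < 0 := by
        simpa using ht
      have hnorm : ‖((t⁻¹ : ℝ) : ℂ) * -Complex.I‖ = t⁻¹ := by
        rw [norm_mul, norm_neg, Complex.norm_I, mul_one, Complex.norm_real,
          Real.norm_of_nonneg (inv_pos.2 ht).le]
      have h1 := (hM _ him (by rw [hnorm]; exact hNM.trans hNt)).sub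
        (hM' _ him (by rw [hnorm]; exact hNM'.trans hNt))
      rw [sub_self] at h1
      have h2 := h1.mul_left ((t⁻¹ : ℝ) : ℂ)
      rw [mul_zero] at h2
      refine h2.congr_fun fun γ => ?_
      have ht0 : (t : ℂ) ≠ 0 := by exact_mod_cast ht.ne'
      have h3 : (((t⁻¹ : ℝ) : ℂ) * -Complex.I) ^ (((γ : ℝ) : ℂ) + 1) =
          ((t ^ (γ : ℝ) : ℝ) : ℂ)⁻¹ * (t : ℂ)⁻¹ * (-Complex.I) ^ (((γ : ℝ) : ℂ) + 1) := by
        have hI := neg_ne_zero.2 Complex.I_ne_zero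
        have ht' : ((t⁻¹ : ℝ) : ℂ) ≠ 0 := by exact_mod_cast (inv_pos.2 ht).ne'
        rw [Complex.cpow_def_of_ne_zero (mul_ne_zero ht' hI), Complex.cpow_def_of_ne_zero hI,
          Complex.log_ofReal_mul (inv_pos.2 ht) hI, Real.rpow_def_of_pos ht, Complex.ofReal_exp]
        nth_rewrite 3 [← Real.exp_log ht]
        rw [Complex.ofReal_exp, ← Complex.exp_neg, ← Complex.exp_neg, ← Complex.exp_add,
          ← Complex.exp_add, Real.log_inv]
        congr 1
        push_cast
        ring
      have h4 : ((t ^ (γ : ℝ) : ℝ) : ℂ) ≠ 0 := by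
        exact_mod_cast (Real.rpow_pos_of_pos ht _).ne'
      have h5 : (-Complex.I) ^ (((γ : ℝ) : ℂ) + 1) ≠ 0 := by
        simp [Complex.cpow_eq_zero_iff]
      rw [h3, Complex.ofReal_inv]
      field_simp
  funext γ
  have h1 := congrFun h0 γ
  have h5 : (-Complex.I) ^ (((γ : ℝ) : ℂ) + 1) ≠ 0 := by
    simp [Complex.cpow_eq_zero_iff]
  simpa [h5, sub_eq_zero] using h1

variable [IsProbabilityMeasure μ]

/-- A geometrically bounded Cauchy expansion yields the Fourier expansion with the same
coefficients. -/
lemma HasCauchyExpansion.hasFourierExpansion (hS : IsExponentSet S c) (hA : 0 < A)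
    (hm : ∀ γ : S, ‖m γ‖ ≤ B * A ^ (γ : ℝ)) (h : HasCauchyExpansion S μ m) :
    HasFourierExpansion S μ m := by
  obtain ⟨M, hM⟩ := h
  -- On `Re s ≥ σ` the termwise transform converges, and `|-is| ≥ Re s > M` allows the Cauchy
  -- expansion at `-is`.
  set σ := max (c * A) (max M 0) + 1 with hσ
  have hσ1 : c * A < σ := (le_max_left _ _).trans_lt (lt_add_one _)
  have hσ2 : M < σ := ((le_max_left _ _).trans (le_max_right _ _)).trans_lt (lt_add_one _)
  have hσ3 : 0 < σ := ((le_max_right _ _).trans (le_max_right _ _)).trans_lt (lt_add_one _)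
  set ψ : ℝ → ℂ := fun t => ∑' γ : S, fourierTerm m γ t with hψ
  have hψc : ContinuousOn ψ (Ioi 0) := continuousOn_tsum_fourierTerm hS hA hm
  have hφc : Continuous (charFun μ) := continuous_charFun
  have hφint : ∀ s : ℂ, 0 < s.re →
      IntegrableOn (fun t : ℝ => charFun μ t * Complex.exp (-s * t)) (Ioi 0) := fun s hs => by
    refine (exp_neg_integrableOn_Ioi 0 hs).mono'
      (Continuous.aestronglyMeasurable (by fun_prop)) (ae_of_all _ fun t => ?_)
    rw [norm_mul, Complex.norm_exp]
    refine (mul_le_of_le_one_left (Real.exp_pos _).le (norm_charFun_le_one t)).trans_eq ?_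
    simp
  have hlap : ∀ s : ℂ, σ ≤ s.re → ∫ t : ℝ in Ioi 0, ψ t * Complex.exp (-s * t) =
      ∫ t : ℝ in Ioi 0, charFun μ t * Complex.exp (-s * t) := fun s hs => by
    rw [laplace_charFun (hσ3.trans_le hs)]
    refine (hasSum_laplace_fourierTerm hS hA hm (hσ1.trans_le hs)).2.unique
      ((hM (-Complex.I * s) ?_ ?_).mul_left _)
    · simp
      linarith
    · rw [norm_mul, norm_neg, Complex.norm_I, one_mul]
      exact (hσ2.trans_le hs).trans_le (Complex.re_le_norm s)
  -- The weight `e^{-σt}` makes the difference integrable and turns the line `Re s = σ` into a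
  -- Fourier transform.
  have hzero := eq_zero_of_integral_exp_eq_zero
    (g := fun t => ψ t * Complex.exp (-σ * t) - charFun μ t * Complex.exp (-σ * t))
    ((hasSum_laplace_fourierTerm hS hA hm (s := σ) (by simpa using hσ1)).1.sub
      (hφint σ (by simpa using hσ3)))
    ((hψc.mul (by fun_prop)).sub (by fun_prop)) fun y => by
      have hre : (σ + y * Complex.I : ℂ).re = σ := by simp
      have h1 := hlap (σ + y * Complex.I) hre.ge
      have h2 := (hasSum_laplace_fourierTerm hS hA hm (s := σ + y * Complex.I)
        (by rw [hre]; exact hσ1)).1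
      have h3 := hφint (σ + y * Complex.I) (by rw [hre]; exact hσ3)
      rw [← sub_eq_zero, ← integral_sub h2 h3] at h1
      rw [← h1]
      refine integral_congr_ae (ae_of_all _ fun t => ?_)
      have h4 : Complex.exp (-(σ + y * Complex.I) * t) =
          Complex.exp (-σ * t) * Complex.exp (-(y * Complex.I) * t) := by
        rw [← Complex.exp_add]
        congr 1
        ring
      simp only [h4]
      ring
  intro t ht
  have h1 := hzero t ht
  rw [← sub_mul, mul_eq_zero, or_iff_left (Complex.exp_ne_zero _), sub_eq_zero] at h1
  rw [← h1]
  exact (summable_fourierTerm hS hA hm ht).hasSum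

/-- As `t → 0+` only the exponent `0` survives, while the characteristic function tends to the total
mass `1`. -/
lemma HasFourierExpansion.eq_one (hS : IsExponentSet S c) (h : HasFourierExpansion S μ m) (γ : S)
    (hγ : (γ : ℝ) = 0) : m γ = 1 := by
  have h1 := IsExponentSet.tendsto_div_rpow (f := fun t => charFun μ t) one_pos
    (fun t ht _ => h t ht) γ (fun η _ => by rw [hγ]; exact hS.nonneg _ η.2)
  have h2 : Tendsto (fun t : ℝ => charFun μ t) (𝓝[>] 0) (𝓝 (charFun μ 0)) :=
    (continuous_charFun.tendsto 0).mono_left nhdsWithin_le_nhds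
  simp only [hγ, Real.rpow_zero, Complex.ofReal_one, div_one, zero_add, Real.Gamma_one,
    Complex.ofReal_zero, Complex.cpow_zero, mul_one] at h1
  rw [charFun_zero, probReal_univ, Complex.ofReal_one] at h2
  exact tendsto_nhds_unique h1 h2

/-- A measure of class `P` has a family of complex moments, which also are the coefficients of the
expansion of its Cauchy transform. -/
lemma exists_complexMomentFamily (hS : IsExponentSet S c) (hμ : ClassP S c μ) :
    ∃ m : S → ℂ, IsComplexMomentFamily S μ m ∧ HasCauchyExpansion S μ m := by
  obtain ⟨m, A, hA, hm, hG⟩ := exists_hasCauchyExpansion hS hμ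
  have hF : HasFourierExpansion S μ m := by
    -- The geometric bound covers only `γ > 0`; the constant `B` accommodates the coefficient at
    -- `0`.
    refine hG.hasFourierExpansion hS (B := max 1 ‖m ⟨0, hS.zero_mem⟩‖) hA fun γ => ?_
    rcases (hS.nonneg _ γ.2).eq_or_lt with h | h
    · have : γ = ⟨0, hS.zero_mem⟩ := Subtype.ext h.symm
      rw [← h, Real.rpow_zero, mul_one, this]
      exact le_max_right _ _
    · exact (hm γ h).trans (le_mul_of_one_le_left (Real.rpow_nonneg hA.le _) (le_max_left _ _))
  exact ⟨m, ⟨fun γ hγ => hF.eq_one hS γ hγ, ⟨A, hA, hm⟩, hF⟩, hG⟩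

end

end PowerLaw

/-! ### The main theorem -/

theorem mainTheorem7 (S : AddSubsemigroup ℝ) (c : ℝ) (hS : PowerLaw.IsExponentSet S c)
    (μ : MeasureTheory.Measure ℝ) [MeasureTheory.IsProbabilityMeasure μ]
    (hμ : PowerLaw.ClassP S c μ) :
    PowerLaw.IsComplexMomentFamily S μ (PowerLaw.complexMoment S μ) ∧
    (∀ m : S → ℂ, PowerLaw.HasFourierExpansion S μ m → m = PowerLaw.complexMoment S μ) ∧
    PowerLaw.HasCauchyExpansion S μ (PowerLaw.complexMoment S μ) ∧
    (∀ d : S → ℂ, PowerLaw.HasCauchyExpansion S μ d →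
      ∀ γ : S, d γ = PowerLaw.complexMoment S μ γ) := by
  obtain ⟨m, hm, hG⟩ := PowerLaw.exists_complexMomentFamily hS hμ
  have hex : ∃ m : S → ℂ, PowerLaw.IsComplexMomentFamily S μ m := ⟨m, hm⟩
  have hfam : PowerLaw.IsComplexMomentFamily S μ (PowerLaw.complexMoment S μ) := by
    rw [PowerLaw.complexMoment, dif_pos hex]
    exact hex.choose_spec
  -- `complexMoment` is an arbitrary choice; uniqueness of the Fourier expansion identifies it with
  -- the constructed family, which carries the Cauchy expansion.
  have heq : m = PowerLaw.complexMoment S μ := hm.expansion.unique hS hfam.expansion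
  refine ⟨hfam, fun m' hm' => hm'.unique hS hfam.expansion, heq ▸ hG, fun d hd γ => ?_⟩
  rw [← heq, hd.unique hS hG]
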